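/- Let $d \ge 2$ and let $P \subset \mathbb{R}^d$ be a simple $d$-polytope, that is, a $d$-dimensional convex polytope each of whose vertices lies on exactly $d$ edges. Let $m$ be the number of facets of $P$, let $n$ be a real number such that $P$ has at least $n$ vertices, and let $p \in [0,1]$ and $q = 1-p$. Let $Q \sim \mathcal{B}(P,p)$ be the convex hull of a random set of vertices of $P$ in which each vertex of $P$ is included independently with probability $p$. The facets of $Q$ are its nonempty faces of dimension $\dim Q - 1$ (where $\dim Q$ may be smaller than $d$). Then the expected number of facets of $Q$ is at least $$p^d m + n q p^d .$$ Moreover, for every $\varepsilon > 0$, the probability that the number of facets of $Q$ is at least $(1-\varepsilon)(p^d m + n q p^d)$ is at least $$1 - e^{-2(\varepsilon q p^d/d)^2 n} - e^{-(m p^d \varepsilon^2)/2} .$$ -/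

import Mathlib

open MeasureTheory ProbabilityTheory

/-- A polytope: the convex hull of a finite set of points. -/
def IsPolytope {d : ℕ} (P : Set (EuclideanSpace ℝ (Fin d))) : Prop :=
  ∃ S : Set (EuclideanSpace ℝ (Fin d)), S.Finite ∧ P = convexHull ℝ S

/-- The dimension of a (nonempty) set of points: the dimension of its affine span. -/
noncomputable def polyDim {d : ℕ} (P : Set (EuclideanSpace ℝ (Fin d))) : ℕ :=
  Module.finrank ℝ (vectorSpan ℝ P)

/-- A nonempty face of `P`: the set of points of `P` at which some linear functional attains its
maximum over `P`. (The zero functional gives `P` itself.) -/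
def IsFace {d : ℕ} (P F : Set (EuclideanSpace ℝ (Fin d))) : Prop :=
  F.Nonempty ∧ IsExposed ℝ P F

/-- The vertices of a polytope. -/
def vertices {d : ℕ} (P : Set (EuclideanSpace ℝ (Fin d))) : Set (EuclideanSpace ℝ (Fin d)) :=
  Set.extremePoints ℝ P

/-- The edges of a polytope: its one-dimensional faces. -/
def edges {d : ℕ} (P : Set (EuclideanSpace ℝ (Fin d))) : Set (Set (EuclideanSpace ℝ (Fin d))) :=
  {F | IsFace P F ∧ polyDim F = 1}

/-- The facets of a polytope: its nonempty faces of dimension one less than that of the polytope.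
The dimension of `P` is not assumed to be that of the ambient space. -/
def facets {d : ℕ} (P : Set (EuclideanSpace ℝ (Fin d))) : Set (Set (EuclideanSpace ℝ (Fin d))) :=
  {F | IsFace P F ∧ polyDim F + 1 = polyDim P}

/-- A simple `d`-polytope in `ℝ^d`: a polytope of full dimension `d` each of whose vertices lies on
exactly `d` edges. -/
def IsSimplePolytope {d : ℕ} (P : Set (EuclideanSpace ℝ (Fin d))) : Prop :=
  IsPolytope P ∧ polyDim P = d ∧ ∀ v ∈ vertices P, {F ∈ edges P | v ∈ F}.ncard = d

/-- The law of the binomial random sample of the vertices of `P`: each vertex of `P` is included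
independently with probability `p`. -/
noncomputable def vertexSample {d : ℕ} (P : Set (EuclideanSpace ℝ (Fin d))) (p : unitInterval) :
    Measure (Set (vertices P)) :=
  setBernoulli Set.univ p

/-- The convex hull of a sample `S` of the vertices of `P`. For `S` distributed according to
`vertexSample P p`, this is the random polytope `Q ∼ B(P, p)`. -/
def sampledPolytope {d : ℕ} (P : Set (EuclideanSpace ℝ (Fin d))) (S : Set (vertices P)) :
    Set (EuclideanSpace ℝ (Fin d)) :=
  convexHull ℝ ((fun v : vertices P => (v : EuclideanSpace ℝ (Fin d))) '' S)

/-- The number of facets of the convex hull of a sample `S` of the vertices of `P`. -/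
noncomputable def numFacets {d : ℕ} (P : Set (EuclideanSpace ℝ (Fin d))) (S : Set (vertices P)) :
    ℕ :=
  (facets (sampledPolytope P S)).ncard

/-!
The number of facets of the sampled polytope `Q` is bounded below by a sum of local contributions,
whose mean is computed exactly and whose lower tail is controlled by McDiarmid's inequality.

*Local structure.* At a vertex `v` of a simple polytope `P` the differences to the `d` neighbours
form a basis, and `P` lies in the orthant with apex `v` that they span
(`IsSimplePolytope.exists_basis`). This follows from the simplex principle
`le_of_forall_nbrSet_le`: a vertex that minimizes a linear functional among its neighbours minimizes
it over `P`. Hence each facet through `v` misses exactly one neighbour of `v` and is determined by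
it. Moreover, `v` is the only vertex of `P` strictly beyond the hyperplane through its neighbours
(`IsSimplePolytope.exists_cutFunctional`): a vertex beyond it at which the cutting functional is
minimal is not adjacent to `v`, so it would be a global minimum, which only `v` is.

*Facets of the sample.* Call a facet `F` of `P` hit if, for some vertex `v` of `F`, the sample
contains `v` and its `d - 1` neighbours in `F`; call `v` cut if the sample contains all neighbours
of `v` but not `v`. Hit facets and cut vertices give linear functionals, no two of them positively
proportional, each of which exposes a `(d - 1)`-dimensional face of `Q`. If `dim Q = d`, these are
distinct facets of `Q`. If `dim Q = d - 1`, the functionals are all proportional, so there are at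
most two of them, while a polytope of positive dimension has at least two facets
(`card_le_ncard_facets`). So `Q` has at least as many facets as there are hit facets and cut
vertices together.

*Balanced weights.* The hit facets are counted with weights: every pair of a facet `F` and a vertex
`v` of `F` as above contributes `1 / f₀(F)`, where `f₀(F) ≥ d` is the number of vertices of `F`. The
resulting lower bound `SimpleIncidence.localCount` has mean exactly `p ^ d m + N q p ^ d`, where `N`
is the number of vertices of `P`. Adding one vertex to the sample changes it by at most `d`
(`SimpleIncidence.abs_localCount_insert_sub_le`): a neighbour of the new vertex gains at most
`1 - 1 / d` if it is in the sample and at most `1` otherwise, and the new vertex itself contributes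
at most `1 / d` for each neighbour in the sample. McDiarmid's inequality, proved for binomial random
sets by induction on the ground set, then bounds the lower tail by the first of the two exponential
terms alone; the events of different facets being hit are dependent, but nothing about their
joint distribution is needed.
-/

/-! ### Expectations over binomial random subsets, and McDiarmid's inequality -/

/-- The expectation of `f A`, where `A` is a random subset of the finite set `s` that includes each
element independently with probability `p`, as an explicit finite sum. -/
noncomputable def binomialExp {V : Type*} [DecidableEq V] (p : ℝ) (s : Finset V)
    (f : Finset V → ℝ) : ℝ :=
  ∑ A ∈ s.powerset, p ^ A.card * (1 - p) ^ (s \ A).card * f A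

section BinomialExp

variable {V : Type*} [DecidableEq V]

theorem binomialExp_insert (p : ℝ) {s : Finset V} {i : V} (hi : i ∉ s) (f : Finset V → ℝ) :
    binomialExp p (insert i s) f =
      binomialExp p s (fun A => p * f (insert i A) + (1 - p) * f A) := by
  unfold binomialExp
  rw [Finset.sum_powerset_insert hi, ← Finset.sum_add_distrib]
  refine Finset.sum_congr rfl fun A hA => ?_
  have hAs := Finset.mem_powerset.1 hA
  have hiA : i ∉ A := fun h => hi (hAs h)
  have h1 : insert i s \ A = insert i (s \ A) := by grind
  have h2 : insert i s \ insert i A = s \ A := by grind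
  have h3 : i ∉ s \ A := by grind
  rw [h1, h2, Finset.card_insert_of_notMem hiA, Finset.card_insert_of_notMem h3]
  ring

theorem binomialExp_mono {p : ℝ} (hp : 0 ≤ p) (hp1 : p ≤ 1) {s : Finset V} {f g : Finset V → ℝ}
    (h : ∀ A ⊆ s, f A ≤ g A) : binomialExp p s f ≤ binomialExp p s g := by
  refine Finset.sum_le_sum fun A hA => ?_
  have : 0 ≤ 1 - p := by linarith
  exact mul_le_mul_of_nonneg_left (h A (Finset.mem_powerset.1 hA)) (by positivity)

theorem binomialExp_const_mul (p c : ℝ) (s : Finset V) (f : Finset V → ℝ) :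
    binomialExp p s (fun A => c * f A) = c * binomialExp p s f := by
  unfold binomialExp
  rw [Finset.mul_sum]
  exact Finset.sum_congr rfl fun A _ => by ring

theorem binomialExp_add (p : ℝ) (s : Finset V) (f g : Finset V → ℝ) :
    binomialExp p s (fun A => f A + g A) = binomialExp p s f + binomialExp p s g := by
  unfold binomialExp
  rw [← Finset.sum_add_distrib]
  exact Finset.sum_congr rfl fun A _ => by ring

theorem binomialExp_sum {ι : Type*} (p : ℝ) (s : Finset V) (t : Finset ι)
    (f : ι → Finset V → ℝ) :
    binomialExp p s (fun A => ∑ i ∈ t, f i A) = ∑ i ∈ t, binomialExp p s (f i) := by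
  unfold binomialExp
  rw [Finset.sum_comm]
  exact Finset.sum_congr rfl fun A _ => by rw [Finset.mul_sum]

/-- By independence, the expectation of a product over the ground set of functions of the single
membership events is the product of their expectations. -/
theorem binomialExp_prod (p : ℝ) (s : Finset V) (x y : V → ℝ) :
    binomialExp p s (fun A => (∏ i ∈ A, x i) * ∏ i ∈ s \ A, y i) =
      ∏ i ∈ s, (p * x i + (1 - p) * y i) := by
  rw [Finset.prod_add]
  refine Finset.sum_congr rfl fun A _ => ?_
  rw [Finset.prod_mul_distrib, Finset.prod_mul_distrib, Finset.prod_const, Finset.prod_const]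
  ring

/-- A prescribed set `a` is contained in the random set, and a prescribed set `b` is avoided by it,
with probability `p ^ |a| (1 - p) ^ |b|`. -/
theorem binomialExp_indicator (p : ℝ) {s a b : Finset V} (ha : a ⊆ s) (hb : b ⊆ s)
    (hab : Disjoint a b) :
    binomialExp p s (fun A => if a ⊆ A ∧ Disjoint b A then 1 else 0) =
      p ^ a.card * (1 - p) ^ b.card := by
  have key := binomialExp_prod p s (fun i => if i ∈ b then 0 else 1)
    (fun i => if i ∈ a then 0 else 1)
  have h1 : ∀ A ⊆ s, (if a ⊆ A ∧ Disjoint b A then (1 : ℝ) else 0) =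
      (∏ i ∈ A, if i ∈ b then (0 : ℝ) else 1) * ∏ i ∈ s \ A, if i ∈ a then (0 : ℝ) else 1 := by
    intro A hA
    split_ifs with h
    · rw [Finset.prod_eq_one, Finset.prod_eq_one, one_mul]
      · intro i hi
        rw [if_neg]
        intro hia
        exact (Finset.mem_sdiff.1 hi).2 (h.1 hia)
      · intro i hi
        rw [if_neg]
        intro hib
        exact Finset.disjoint_left.1 h.2 hib hi
    · rw [not_and_or] at h
      rcases h with h | h
      · obtain ⟨i, hia, hiA⟩ := Finset.not_subset.1 h
        rw [Finset.prod_eq_zero (i := i) (s := s \ A), mul_zero]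
        · simp [hiA, ha hia]
        · simp [hia]
      · obtain ⟨i, hib, hiA⟩ := Finset.not_disjoint_iff.1 h
        rw [Finset.prod_eq_zero (i := i) hiA (by simp [hib]), zero_mul]
  have h2 : binomialExp p s (fun A => if a ⊆ A ∧ Disjoint b A then (1 : ℝ) else 0) =
      binomialExp p s (fun A => (∏ i ∈ A, if i ∈ b then (0 : ℝ) else 1) *
        ∏ i ∈ s \ A, if i ∈ a then (0 : ℝ) else 1) :=
    Finset.sum_congr rfl fun A hA => congrArg _ (h1 A (Finset.mem_powerset.1 hA))
  rw [h2, key]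
  have h3 : ∀ i ∈ s, p * (if i ∈ b then (0 : ℝ) else 1) + (1 - p) * (if i ∈ a then (0 : ℝ) else 1) =
      (if i ∈ a then p else 1) * (if i ∈ b then 1 - p else 1) := by
    intro i _
    by_cases hia : i ∈ a
    · simp [hia, Finset.disjoint_left.1 hab hia]
    · by_cases hib : i ∈ b <;> simp [hia, hib]
  rw [Finset.prod_congr rfl h3, Finset.prod_mul_distrib, Finset.prod_ite_mem, Finset.prod_ite_mem,
    Finset.inter_eq_right.2 ha, Finset.inter_eq_right.2 hb, Finset.prod_const, Finset.prod_const]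

/-- Hoeffding's lemma for a two-point distribution. -/
theorem two_point_exp_le {p : ℝ} (hp : 0 ≤ p) (hp1 : p ≤ 1) (a b c : ℝ) (h : |a - b| ≤ c) :
    p * Real.exp a + (1 - p) * Real.exp b ≤
      Real.exp (p * a + (1 - p) * b + c ^ 2 / 8) := by
  let μ : Measure Bool := p.toNNReal • Measure.dirac true +
    (1 - p).toNNReal • Measure.dirac false
  have hprob : IsProbabilityMeasure μ := ⟨by
    simp only [μ, Measure.add_apply, Measure.smul_apply, measure_univ, ENNReal.smul_def,
      smul_eq_mul, mul_one]
    rw [← ENNReal.coe_add, ← Real.toNNReal_add hp (by linarith)]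
    simp⟩
  have hint : ∀ f : Bool → ℝ, ∫ x, f x ∂μ = p * f true + (1 - p) * f false := by
    intro f
    rw [integral_add_measure (Integrable.of_finite) (Integrable.of_finite),
      integral_smul_nnreal_measure, integral_smul_nnreal_measure, integral_dirac, integral_dirac,
      NNReal.smul_def, NNReal.smul_def, Real.coe_toNNReal p hp,
      Real.coe_toNNReal _ (by linarith), smul_eq_mul, smul_eq_mul]
  let X : Bool → ℝ := fun x => if x then a else b
  have hX := (hasSubgaussianMGF_of_mem_Icc (μ := μ) (X := X) (a := min a b) (b := max a b)
    (by fun_prop) (Filter.Eventually.of_forall fun x => by cases x <;> simp [X])).mgf_le 1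
  rw [mgf, hint, hint] at hX
  simp only [X, if_true, Bool.false_eq_true, if_false, one_mul, Real.exp_sub] at hX
  rw [max_sub_min_eq_abs] at hX
  have e : p * (Real.exp a / Real.exp (p * a + (1 - p) * b)) +
      (1 - p) * (Real.exp b / Real.exp (p * a + (1 - p) * b)) =
      (p * Real.exp a + (1 - p) * Real.exp b) / Real.exp (p * a + (1 - p) * b) := by ring
  rw [e, div_le_iff₀ (Real.exp_pos _), ← Real.exp_add] at hX
  refine hX.trans (Real.exp_le_exp.2 ?_)
  have hsq : |b - a| ^ 2 ≤ c ^ 2 := by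
    rw [abs_sub_comm]
    gcongr
  push_cast
  simp only [Real.norm_eq_abs, abs_abs]
  linarith

/-- The exponential moment bound behind McDiarmid's inequality: if adding an element to the random
set changes `f` by at most `c`, the variance proxy of `f` is at most `|s| c² / 4`. -/
theorem binomialExp_exp_le {p : ℝ} (hp : 0 ≤ p) (hp1 : p ≤ 1) (c : ℝ) (s : Finset V) :
    ∀ f : Finset V → ℝ, (∀ A ⊆ s, ∀ i ∈ s, i ∉ A → |f (insert i A) - f A| ≤ c) →
      binomialExp p s (fun A => Real.exp (f A)) ≤
        Real.exp (binomialExp p s f + s.card * c ^ 2 / 8) := by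
  induction s using Finset.induction_on with
  | empty => intro f _; simp [binomialExp]
  | insert i s hi ih =>
    intro f hf
    rw [binomialExp_insert p hi, binomialExp_insert p hi, Finset.card_insert_of_notMem hi]
    set g : Finset V → ℝ := fun A => p * f (insert i A) + (1 - p) * f A with hg
    have hq : 0 ≤ 1 - p := by linarith
    have hbd : ∀ A ⊆ s, ∀ j ∈ s, j ∉ A → |g (insert j A) - g A| ≤ c := by
      intro A hA j hj hjA
      have hij : i ≠ j := fun h => hi (h ▸ hj)
      have h1 := hf (insert i A) (Finset.insert_subset_insert i hA) j
        (Finset.mem_insert_of_mem hj) (by simp [hjA, hij.symm])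
      have h2 := hf A (hA.trans (Finset.subset_insert i s)) j (Finset.mem_insert_of_mem hj) hjA
      rw [Finset.insert_comm] at h1
      have e : g (insert j A) - g A = p * (f (insert i (insert j A)) - f (insert i A)) +
          (1 - p) * (f (insert j A) - f A) := by simp only [hg]; ring
      rw [e]
      rw [abs_le] at *
      constructor <;> nlinarith
    calc binomialExp p s (fun A => p * Real.exp (f (insert i A)) + (1 - p) * Real.exp (f A))
        ≤ binomialExp p s (fun A => Real.exp (c ^ 2 / 8) * Real.exp (g A)) := by
          refine binomialExp_mono hp hp1 fun A hA => ?_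
          rw [← Real.exp_add, add_comm (c ^ 2 / 8)]
          exact two_point_exp_le hp hp1 _ _ c
            (hf A (hA.trans (Finset.subset_insert i s)) i (Finset.mem_insert_self i s)
              fun h => hi (hA h))
      _ = Real.exp (c ^ 2 / 8) * binomialExp p s (fun A => Real.exp (g A)) :=
          binomialExp_const_mul _ _ _ _
      _ ≤ Real.exp (c ^ 2 / 8) * Real.exp (binomialExp p s g + s.card * c ^ 2 / 8) :=
          mul_le_mul_of_nonneg_left (ih g hbd) (Real.exp_pos _).le
      _ = _ := by
          rw [← Real.exp_add]
          congr 1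
          push_cast
          ring

/-- **McDiarmid's inequality**, lower tail, for a function of a binomial random set. -/
theorem binomialExp_lower_tail {p : ℝ} (hp : 0 ≤ p) (hp1 : p ≤ 1) {c : ℝ} (hc : 0 < c)
    {s : Finset V} (hs : s.Nonempty) (f : Finset V → ℝ)
    (hf : ∀ A ⊆ s, ∀ i ∈ s, i ∉ A → |f (insert i A) - f A| ≤ c) {t : ℝ} (ht : 0 ≤ t) :
    binomialExp p s (fun A => if f A ≤ binomialExp p s f - t then 1 else 0) ≤
      Real.exp (-2 * t ^ 2 / (s.card * c ^ 2)) := by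
  have hN : (0 : ℝ) < s.card := by exact_mod_cast hs.card_pos
  -- The optimal exponential tilt.
  set l : ℝ := 4 * t / (s.card * c ^ 2) with hl
  have hl0 : 0 ≤ l := by positivity
  set M := binomialExp p s f with hM
  have hmean : binomialExp p s (fun A => -l * f A) = -l * M := binomialExp_const_mul _ _ _ _
  have key := binomialExp_exp_le hp hp1 (l * c) s (fun A => -l * f A) (by
    intro A hA i hi hiA
    have e : -l * f (insert i A) - -l * f A = -l * (f (insert i A) - f A) := by ring
    rw [e, abs_mul, abs_neg, abs_of_nonneg hl0]
    exact mul_le_mul_of_nonneg_left (hf A hA i hi hiA) hl0)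
  rw [hmean] at key
  calc binomialExp p s (fun A => if f A ≤ M - t then 1 else 0)
      ≤ binomialExp p s (fun A => Real.exp (l * (M - t)) * Real.exp (-l * f A)) := by
        refine binomialExp_mono hp hp1 fun A _ => ?_
        rw [← Real.exp_add]
        split_ifs with h
        · refine Real.one_le_exp ?_
          nlinarith
        · exact (Real.exp_pos _).le
    _ = Real.exp (l * (M - t)) * binomialExp p s (fun A => Real.exp (-l * f A)) :=
        binomialExp_const_mul _ _ _ _
    _ ≤ Real.exp (l * (M - t)) * Real.exp (-l * M + s.card * (l * c) ^ 2 / 8) :=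
        mul_le_mul_of_nonneg_left key (Real.exp_pos _).le
    _ = _ := by
        rw [← Real.exp_add]
        congr 1
        rw [hl]
        field_simp
        ring

/-- Integration against the Bernoulli law on the subsets of a finite type is the finite sum
`binomialExp`. -/
theorem integral_setBernoulli_univ [Fintype V] (p : unitInterval) (f : Set V → ℝ) :
    ∫ S, f S ∂(setBernoulli Set.univ p) =
      binomialExp (p : ℝ) Finset.univ (fun A : Finset V => f (A : Set V)) := by
  rw [integral_fintype (Integrable.of_finite)]
  unfold binomialExp
  rw [Finset.powerset_univ]
  classical
  refine (Fintype.sum_equiv (Fintype.finsetEquivSet (α := V)) _ _ fun A => ?_).symm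
  rw [setBernoulli_real_singleton p (Set.subset_univ _) Set.finite_univ]
  simp only [Fintype.finsetEquivSet_apply, smul_eq_mul, Set.ncard_coe_finset]
  congr 2
  rw [← Set.ncard_coe_finset]
  simp

end BinomialExp

/-! ### The vertex-facet incidences of a simple polytope and the local count -/

/-- The combinatorial data of a simple `d`-polytope with vertices `V` and facets `ι`: the neighbours
`nbr v` of a vertex and the vertex set `inc F` of a facet. Every facet through a vertex misses
exactly one of its `d` neighbours, and the facet is determined by which one it misses. -/
structure SimpleIncidence (V ι : Type*) [DecidableEq V] (d : ℕ) where
  nbr : V → Finset V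
  inc : ι → Finset V
  card_nbr : ∀ v, (nbr v).card = d
  nbr_symm : ∀ {u v}, u ∈ nbr v → v ∈ nbr u
  notMem_nbr : ∀ v, v ∉ nbr v
  le_card_inc : ∀ F, d ≤ (inc F).card
  card_missing : ∀ {v F}, v ∈ inc F → (nbr v \ inc F).card = 1
  inc_ext : ∀ {v F F'}, v ∈ inc F → v ∈ inc F' → nbr v \ inc F = nbr v \ inc F' → F = F'

namespace SimpleIncidence

variable {V ι : Type*} [DecidableEq V] {d : ℕ} (I : SimpleIncidence V ι d)

theorem card_nbr_inter_inc {v : V} {F : ι} (h : v ∈ I.inc F) :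
    (I.nbr v ∩ I.inc F).card + 1 = d := by
  rw [← I.card_missing h, Finset.card_inter_add_card_sdiff, I.card_nbr]

theorem inv_card_inc_le (hd : 2 ≤ d) (F : ι) : ((I.inc F).card : ℝ)⁻¹ ≤ (d : ℝ)⁻¹ := by
  have : (0 : ℝ) < d := by positivity
  exact inv_anti₀ this (by exact_mod_cast I.le_card_inc F)

variable [Fintype ι]

/-- The contribution of a chosen vertex `v`: the facets through `v` all of whose neighbours of `v`
are chosen, each weighted by the reciprocal of its number of vertices. -/
noncomputable def ownCount (v : V) (A : Finset V) : ℝ :=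
  ∑ F, if v ∈ I.inc F ∧ I.nbr v ∩ I.inc F ⊆ A then ((I.inc F).card : ℝ)⁻¹ else 0

/-- The contribution of a vertex `v` to the local count: `ownCount` if `v` is chosen; otherwise `1`
or `0` according to whether all neighbours of `v` are chosen. -/
noncomputable def vertexCount (v : V) (A : Finset V) : ℝ :=
  if v ∈ A then I.ownCount v A else if I.nbr v ⊆ A then 1 else 0

theorem ownCount_nonneg (v : V) (A : Finset V) : 0 ≤ I.ownCount v A :=
  Finset.sum_nonneg fun F _ => by split_ifs <;> positivity

/-- Facets through `v` that miss only neighbours in `B` are at most as many as `B`. -/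
theorem card_filter_missing_le (v : V) (B : Finset V) (q : ι → Prop) [DecidablePred q]
    (hq : ∀ F, q F → v ∈ I.inc F ∧ I.nbr v \ I.inc F ⊆ B) :
    (Finset.univ.filter q).card ≤ B.card := by
  rw [← Nat.choose_one_right B.card, ← Finset.card_powersetCard]
  refine Finset.card_le_card_of_injOn (fun F => I.nbr v \ I.inc F) ?_ ?_
  · intro F hF
    have hF' := hq F (Finset.mem_filter.1 hF).2
    exact Finset.mem_coe.2 (Finset.mem_powersetCard.2 ⟨hF'.2, I.card_missing hF'.1⟩)
  · intro F hF F' hF' h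
    exact I.inc_ext (hq F (Finset.mem_filter.1 hF).2).1 (hq F' (Finset.mem_filter.1 hF').2).1 h

theorem card_own_le (hd : 2 ≤ d) (v : V) (A : Finset V) :
    (Finset.univ.filter fun F => v ∈ I.inc F ∧ I.nbr v ∩ I.inc F ⊆ A).card ≤
      (I.nbr v ∩ A).card := by
  by_cases hk : (I.nbr v ∩ A).card < d
  · rcases Finset.eq_empty_or_nonempty
      (Finset.univ.filter fun F => v ∈ I.inc F ∧ I.nbr v ∩ I.inc F ⊆ A) with he | ⟨F, hF⟩
    · simp [he]
    -- If some neighbour is not chosen, at most one facet is counted.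
    have heq : ∀ F, v ∈ I.inc F → I.nbr v ∩ I.inc F ⊆ A → I.nbr v ∩ I.inc F = I.nbr v ∩ A := by
      intro F h1 h2
      refine Finset.eq_of_subset_of_card_le (Finset.subset_inter Finset.inter_subset_left h2) ?_
      have := I.card_nbr_inter_inc h1
      omega
    simp only [Finset.mem_filter, Finset.mem_univ, true_and] at hF
    have hc : (Finset.univ.filter fun F => v ∈ I.inc F ∧ I.nbr v ∩ I.inc F ⊆ A).card ≤ 1 := by
      rw [Finset.card_le_one]
      intro F hF F' hF'
      simp only [Finset.mem_filter, Finset.mem_univ, true_and] at hF hF'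
      refine I.inc_ext hF.1 hF'.1 ?_
      rw [← Finset.sdiff_inter_self_left, ← Finset.sdiff_inter_self_left _ (I.inc F'),
        heq F hF.1 hF.2, heq F' hF'.1 hF'.2]
    have h1 := I.card_nbr_inter_inc hF.1
    rw [heq F hF.1 hF.2] at h1
    omega
  · refine (I.card_filter_missing_le v (I.nbr v) _ fun F hF => ⟨hF.1, Finset.sdiff_subset⟩).trans ?_
    rw [I.card_nbr]
    omega

theorem ownCount_le (hd : 2 ≤ d) (v : V) (A : Finset V) :
    I.ownCount v A ≤ (I.nbr v ∩ A).card * (d : ℝ)⁻¹ := by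
  have h1 : I.ownCount v A ≤
      ∑ F, if v ∈ I.inc F ∧ I.nbr v ∩ I.inc F ⊆ A then (d : ℝ)⁻¹ else 0 := by
    refine Finset.sum_le_sum fun F _ => ?_
    split_ifs
    · exact I.inv_card_inc_le hd F
    · exact le_rfl
  rw [← Finset.sum_filter, Finset.sum_const, nsmul_eq_mul] at h1
  refine h1.trans (mul_le_mul_of_nonneg_right ?_ (by positivity))
  exact_mod_cast I.card_own_le hd v A

theorem ownCount_mono (v : V) {A B : Finset V} (h : A ⊆ B) : I.ownCount v A ≤ I.ownCount v B := by
  refine Finset.sum_le_sum fun F _ => ?_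
  split_ifs with h1 h2
  · exact le_rfl
  · exact absurd ⟨h1.1, h1.2.trans h⟩ h2
  · positivity
  · exact le_rfl

/-- Choosing a further neighbour `i` of `v` only affects the facets through both `v` and `i`. -/
theorem ownCount_insert_sub_le (hd : 2 ≤ d) {v i : V} (hi : i ∈ I.nbr v) (A : Finset V) :
    I.ownCount v (insert i A) - I.ownCount v A ≤ 1 - (d : ℝ)⁻¹ := by
  have hd0 : (0 : ℝ) < d := by positivity
  unfold ownCount
  rw [← Finset.sum_sub_distrib]
  have h1 : ∀ F ∈ Finset.univ,
      ((if v ∈ I.inc F ∧ I.nbr v ∩ I.inc F ⊆ insert i A then ((I.inc F).card : ℝ)⁻¹ else 0) -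
        if v ∈ I.inc F ∧ I.nbr v ∩ I.inc F ⊆ A then ((I.inc F).card : ℝ)⁻¹ else 0) ≤
      if v ∈ I.inc F ∧ i ∈ I.inc F then (d : ℝ)⁻¹ else 0 := by
    intro F _
    by_cases hv : v ∈ I.inc F
    · by_cases hiF : i ∈ I.inc F
      · have h0 : (0 : ℝ) ≤ ((I.inc F).card : ℝ)⁻¹ := by positivity
        have := I.inv_card_inc_le hd F
        simp only [hv, hiF, true_and, if_true]
        split_ifs <;> linarith
      · have : I.nbr v ∩ I.inc F ⊆ insert i A ↔ I.nbr v ∩ I.inc F ⊆ A :=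
          Finset.subset_insert_iff_of_notMem (by simp [hiF])
        simp [this, hiF]
    · simp [hv]
  refine (Finset.sum_le_sum h1).trans ?_
  rw [← Finset.sum_filter, Finset.sum_const, nsmul_eq_mul]
  have h2 := I.card_filter_missing_le v ((I.nbr v).erase i)
    (fun F => v ∈ I.inc F ∧ i ∈ I.inc F) (fun F hF => ⟨hF.1, fun u hu => by
      have := Finset.mem_sdiff.1 hu
      exact Finset.mem_erase.2 ⟨fun h => this.2 (h ▸ hF.2), this.1⟩⟩)
  rw [Finset.card_erase_of_mem hi, I.card_nbr] at h2
  have h3 : ((Finset.univ.filter fun F => v ∈ I.inc F ∧ i ∈ I.inc F).card : ℝ) ≤ d - 1 := by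
    rw [← Nat.cast_one, ← Nat.cast_sub (by omega)]
    exact_mod_cast h2
  calc _ ≤ ((d : ℝ) - 1) * (d : ℝ)⁻¹ := mul_le_mul_of_nonneg_right h3 (by positivity)
    _ = 1 - (d : ℝ)⁻¹ := by field_simp

variable [Fintype V]

/-- A lower bound for the number of facets of the hull of the chosen vertices `A` that is a sum of
local contributions. -/
noncomputable def localCount (A : Finset V) : ℝ := ∑ v, I.vertexCount v A

/-- Choosing one more vertex changes the local count by at most `d`. The weights are balanced: a
chosen neighbour of the new vertex gains at most `1 - 1 / d`, an unchosen one at most `1`, and the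
own contribution of the new vertex is at most `1 / d` for each chosen neighbour. -/
theorem abs_localCount_insert_sub_le (hd : 2 ≤ d) {i : V} {A : Finset V} (hi : i ∉ A) :
    |I.localCount (insert i A) - I.localCount A| ≤ d := by
  have hd0 : (0 : ℝ) < d := by positivity
  have hd2 : (2 : ℝ) ≤ d := by exact_mod_cast hd
  have hdinv : (d : ℝ)⁻¹ ≤ 1 := inv_le_one_of_one_le₀ (by linarith)
  unfold localCount
  rw [← Finset.sum_sub_distrib]
  have hown : I.ownCount i (insert i A) = I.ownCount i A := by
    refine Finset.sum_congr rfl fun F _ => ?_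
    have : I.nbr i ∩ I.inc F ⊆ insert i A ↔ I.nbr i ∩ I.inc F ⊆ A :=
      Finset.subset_insert_iff_of_notMem (by simp [I.notMem_nbr])
    simp [this]
  have hself : I.vertexCount i (insert i A) - I.vertexCount i A =
      I.ownCount i A - if I.nbr i ⊆ A then 1 else 0 := by
    simp [vertexCount, hi, hown]
  have hfar : ∀ v, v ≠ i → v ∉ I.nbr i → I.vertexCount v (insert i A) - I.vertexCount v A = 0 := by
    intro v hvi hv
    have hiv : i ∉ I.nbr v := fun h => hv (I.nbr_symm h)
    have h1 : ∀ B ⊆ I.nbr v, B ⊆ insert i A ↔ B ⊆ A := fun B hB =>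
      Finset.subset_insert_iff_of_notMem fun h => hiv (hB h)
    have h2 : I.ownCount v (insert i A) = I.ownCount v A :=
      Finset.sum_congr rfl fun F _ => by simp only [h1 _ Finset.inter_subset_left]
    simp [vertexCount, hvi, h2, h1 _ subset_rfl]
  have hnear : ∀ v ∈ I.nbr i, 0 ≤ I.vertexCount v (insert i A) - I.vertexCount v A ∧
      I.vertexCount v (insert i A) - I.vertexCount v A ≤
        1 - if v ∈ A then (d : ℝ)⁻¹ else 0 := by
    intro v hv
    have hvi : v ≠ i := fun h => I.notMem_nbr i (h ▸ hv)
    by_cases hvA : v ∈ A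
    · have h1 := I.ownCount_insert_sub_le hd (I.nbr_symm hv) A
      have h2 := I.ownCount_mono v (Finset.subset_insert i A)
      simp only [vertexCount, hvA, Finset.mem_insert, or_true, if_true]
      exact ⟨by linarith, h1⟩
    · simp only [vertexCount, hvA, Finset.mem_insert, or_false, hvi, if_false]
      have h3 : I.nbr v ⊆ A → I.nbr v ⊆ insert i A := fun h => h.trans (Finset.subset_insert i A)
      split_ifs with h4 h5 h5
      · norm_num
      · norm_num
      · exact absurd (h3 h5) h4
      · norm_num
  have hsplit : ∑ v, (I.vertexCount v (insert i A) - I.vertexCount v A) =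
      (I.ownCount i A - if I.nbr i ⊆ A then 1 else 0) +
        ∑ v ∈ I.nbr i, (I.vertexCount v (insert i A) - I.vertexCount v A) := by
    rw [← hself, ← Finset.sum_insert (f := fun v => I.vertexCount v (insert i A) -
      I.vertexCount v A) (I.notMem_nbr i)]
    refine (Finset.sum_subset (Finset.subset_univ _) fun v _ hv => ?_).symm
    rw [Finset.mem_insert, not_or] at hv
    exact hfar v hv.1 hv.2
  rw [hsplit, abs_le]
  have hb : (0 : ℝ) ≤ (if I.nbr i ⊆ A then (1 : ℝ) else 0) ∧
    (if I.nbr i ⊆ A then (1 : ℝ) else 0) ≤ 1 := by split_ifs <;> norm_num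
  constructor
  · have := Finset.sum_nonneg fun v hv => (hnear v hv).1
    have := I.ownCount_nonneg i A
    linarith
  · have h1 := Finset.sum_le_sum fun v hv => (hnear v hv).2
    rw [Finset.sum_sub_distrib (f := fun _ => (1 : ℝ)), Finset.sum_const, I.card_nbr,
      nsmul_eq_mul, mul_one, Finset.sum_ite_mem, Finset.sum_const, nsmul_eq_mul] at h1
    have h2 := I.ownCount_le hd i A
    linarith

theorem localCount_eq (A : Finset V) :
    I.localCount A =
      (∑ F, ∑ v ∈ I.inc F, ((I.inc F).card : ℝ)⁻¹ *
        if insert v (I.nbr v ∩ I.inc F) ⊆ A ∧ Disjoint ∅ A then 1 else 0) +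
      ∑ v, if I.nbr v ⊆ A ∧ Disjoint {v} A then 1 else 0 := by
  have h1 : ∀ v, I.vertexCount v A =
      (∑ F, if v ∈ I.inc F then (((I.inc F).card : ℝ)⁻¹ *
        if insert v (I.nbr v ∩ I.inc F) ⊆ A ∧ Disjoint ∅ A then 1 else 0) else 0) +
      if I.nbr v ⊆ A ∧ Disjoint {v} A then 1 else 0 := by
    intro v
    by_cases hv : v ∈ A
    · simp [vertexCount, ownCount, hv, Finset.insert_subset_iff, ite_and]
    · simp [vertexCount, hv, Finset.insert_subset_iff]
  unfold localCount
  rw [Finset.sum_congr rfl fun v _ => h1 v, Finset.sum_add_distrib, Finset.sum_comm]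
  congr 1
  refine Finset.sum_congr rfl fun F _ => ?_
  rw [Finset.sum_ite_mem, Finset.univ_inter]

theorem binomialExp_localCount (hd : 2 ≤ d) (p : ℝ) :
    binomialExp p Finset.univ I.localCount =
      p ^ d * Fintype.card ι + Fintype.card V * (1 - p) * p ^ d := by
  rw [show I.localCount = fun A => _ from funext I.localCount_eq, binomialExp_add, binomialExp_sum,
    binomialExp_sum]
  congr 1
  · have : ∀ F ∈ Finset.univ, binomialExp p Finset.univ (fun A => ∑ v ∈ I.inc F,
        ((I.inc F).card : ℝ)⁻¹ *
        if insert v (I.nbr v ∩ I.inc F) ⊆ A ∧ Disjoint ∅ A then 1 else 0) = p ^ d := by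
      intro F _
      rw [binomialExp_sum]
      have h1 : ∀ v ∈ I.inc F, binomialExp p Finset.univ (fun A => ((I.inc F).card : ℝ)⁻¹ *
          if insert v (I.nbr v ∩ I.inc F) ⊆ A ∧ Disjoint ∅ A then 1 else 0) =
          ((I.inc F).card : ℝ)⁻¹ * p ^ d := by
        intro v hv
        rw [binomialExp_const_mul, binomialExp_indicator p (Finset.subset_univ _)
          (Finset.subset_univ _) (Finset.disjoint_empty_right _),
          Finset.card_insert_of_notMem (by simp [I.notMem_nbr]), I.card_nbr_inter_inc hv]
        simp
      have h2 : ((I.inc F).card : ℝ) ≠ 0 := by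
        have := I.le_card_inc F
        exact_mod_cast (by omega : (I.inc F).card ≠ 0)
      rw [Finset.sum_congr rfl h1, Finset.sum_const, nsmul_eq_mul, mul_inv_cancel_left₀ h2]
    rw [Finset.sum_congr rfl this, Finset.sum_const, Finset.card_univ, nsmul_eq_mul, mul_comm]
  · have : ∀ v ∈ Finset.univ, binomialExp p Finset.univ (fun A =>
        if I.nbr v ⊆ A ∧ Disjoint {v} A then 1 else 0) = p ^ d * (1 - p) := by
      intro v _
      rw [binomialExp_indicator p (Finset.subset_univ _) (Finset.subset_univ _)
        (by simp [I.notMem_nbr]), I.card_nbr]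
      simp
    rw [Finset.sum_congr rfl this, Finset.sum_const, Finset.card_univ, nsmul_eq_mul]
    ring

/-- The facets of which a vertex together with its neighbours in the facet is chosen. -/
def hitFacets (A : Finset V) : Finset ι :=
  open Classical in
  Finset.univ.filter fun F => ∃ v ∈ I.inc F, v ∈ A ∧ I.nbr v ∩ I.inc F ⊆ A

/-- The unchosen vertices all of whose neighbours are chosen. -/
def cutVertices (A : Finset V) : Finset V :=
  Finset.univ.filter fun v => v ∉ A ∧ I.nbr v ⊆ A

theorem localCount_le (A : Finset V) :
    I.localCount A ≤ ((I.hitFacets A).card + (I.cutVertices A).card : ℕ) := by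
  classical
  rw [localCount_eq, Nat.cast_add]
  refine add_le_add ?_ (le_of_eq ?_)
  · have : ∀ F ∈ Finset.univ, (∑ v ∈ I.inc F, ((I.inc F).card : ℝ)⁻¹ *
        if insert v (I.nbr v ∩ I.inc F) ⊆ A ∧ Disjoint ∅ A then 1 else 0) ≤
        if F ∈ I.hitFacets A then 1 else 0 := by
      intro F _
      split_ifs with h
      · refine (Finset.sum_le_card_nsmul _ _ ((I.inc F).card : ℝ)⁻¹ fun v _ => ?_).trans ?_
        · refine mul_le_of_le_one_right (by positivity) ?_
          split_ifs <;> norm_num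
        · rw [nsmul_eq_mul]
          exact mul_inv_le_one
      · refine (Finset.sum_eq_zero fun v hv => ?_).le
        rw [if_neg, mul_zero]
        intro h'
        refine h ?_
        simp only [hitFacets, Finset.mem_filter, Finset.mem_univ, true_and]
        exact ⟨v, hv, h'.1 (Finset.mem_insert_self _ _),
          (Finset.subset_insert _ _).trans h'.1⟩
    refine (Finset.sum_le_sum this).trans ?_
    simp
  · rw [Finset.sum_boole]
    congr 2
    ext v
    simp [cutVertices, and_comm]

end SimpleIncidence

/-! ### Faces of the convex hull of a finite set -/

section Faces

variable {E : Type*} [AddCommGroup E] [Module ℝ E]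

/-- The points of `T` at which the linear functional `l` attains its maximum over `T`. -/
def faceSet (T : Set E) (l : E →ₗ[ℝ] ℝ) : Set E := {t ∈ T | ∀ s ∈ T, l s ≤ l t}

theorem faceSet_subset (T : Set E) (l : E →ₗ[ℝ] ℝ) : faceSet T l ⊆ T := fun _ h => h.1

theorem faceSet_nonempty {T : Set E} (hT : T.Finite) (hne : T.Nonempty) (l : E →ₗ[ℝ] ℝ) :
    (faceSet T l).Nonempty := by
  obtain ⟨t, ht, hmax⟩ := Set.exists_max_image T l hT hne
  exact ⟨t, ht, hmax⟩

theorem faceSet_eq_of_mem {T : Set E} {l : E →ₗ[ℝ] ℝ} {x : E} (hx : x ∈ faceSet T l) :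
    faceSet T l = {t ∈ T | l t = l x} := by
  ext t
  constructor
  · exact fun ht => ⟨ht.1, le_antisymm (hx.2 t ht.1) (ht.2 x hx.1)⟩
  · exact fun ht => ⟨ht.1, fun s hs => ht.2 ▸ hx.2 s hs⟩

theorem faceSet_smul (T : Set E) (l : E →ₗ[ℝ] ℝ) {t : ℝ} (ht : 0 < t) :
    faceSet T (t • l) = faceSet T l := by
  simp [faceSet, mul_le_mul_iff_right₀ ht]

theorem mem_faceSet_of_subset {T T' : Set E} {l : E →ₗ[ℝ] ℝ} (h : T ⊆ T') {x : E}
    (hx : x ∈ faceSet T' l) (hxT : x ∈ T) : x ∈ faceSet T l :=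
  ⟨hxT, fun s hs => hx.2 s (h hs)⟩

theorem vectorSpan_le_of_forall_sub_mem {T : Set E} {W : Submodule ℝ E} {x : E} (hx : x ∈ T)
    (h : ∀ t ∈ T, t - x ∈ W) : vectorSpan ℝ T ≤ W := by
  rw [vectorSpan_eq_span_vsub_set_right ℝ hx, Submodule.span_le]
  rintro _ ⟨t, ht, rfl⟩
  exact h t ht

theorem vectorSpan_faceSet_le_ker (T : Set E) (l : E →ₗ[ℝ] ℝ) :
    vectorSpan ℝ (faceSet T l) ≤ LinearMap.ker l := by
  rcases (faceSet T l).eq_empty_or_nonempty with h | ⟨x, hx⟩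
  · simp [h]
  · refine vectorSpan_le_of_forall_sub_mem hx fun t ht => ?_
    rw [faceSet_eq_of_mem hx] at ht
    simp [ht.2]

theorem le_of_mem_convexHull {T : Set E} {l : E →ₗ[ℝ] ℝ} {c : ℝ} (h : ∀ t ∈ T, l t ≤ c) {x : E}
    (hx : x ∈ convexHull ℝ T) : l x ≤ c :=
  convexHull_min (t := {x | l x ≤ c}) h (convex_halfSpace_le l.isLinear c) hx

theorem vectorSpan_convexHull (T : Set E) : vectorSpan ℝ (convexHull ℝ T) = vectorSpan ℝ T := by
  rw [← direction_affineSpan, affineSpan_convexHull, direction_affineSpan]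

/-- A point of the hull of `T` at which the bound `l ≤ c` is attained is a combination of points of
`T` at which it is attained. -/
theorem mem_convexHull_of_apply_eq {T : Set E} {l : E →ₗ[ℝ] ℝ} {c : ℝ} (h : ∀ t ∈ T, l t ≤ c)
    {x : E} (hx : x ∈ convexHull ℝ T) (hxc : l x = c) : x ∈ convexHull ℝ {t ∈ T | l t = c} := by
  -- The union of the open half-space with the hull of the attaining points is convex.
  have hconv : Convex ℝ {x | l x < c ∨ l x = c ∧ x ∈ convexHull ℝ {t ∈ T | l t = c}} := by
    rw [convex_iff_forall_pos]
    rintro y hy z hz a b ha hb hab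
    simp only [Set.mem_ofPred_eq, map_add, map_smul, smul_eq_mul] at hy hz ⊢
    have e : c = a * c + b * c := by rw [← add_mul, hab, one_mul]
    rcases hy with hy | ⟨hy, hy'⟩ <;> rcases hz with hz | ⟨hz, hz'⟩
    · left; nlinarith
    · left; nlinarith
    · left; nlinarith
    · right
      refine ⟨by rw [hy, hz]; linarith, ?_⟩
      exact convex_convexHull ℝ _ hy' hz' ha.le hb.le hab
  have hsub : T ⊆ {x | l x < c ∨ l x = c ∧ x ∈ convexHull ℝ {t ∈ T | l t = c}} := by
    intro t ht
    rcases (h t ht).lt_or_eq with h1 | h1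
    · exact Or.inl h1
    · exact Or.inr ⟨h1, subset_convexHull ℝ _ ⟨ht, h1⟩⟩
  rcases convexHull_min hsub hconv hx with h1 | h1
  · exact absurd hxc h1.ne
  · exact h1.2

theorem convexHull_faceSet (T : Set E) (hT : T.Finite) (l : E →ₗ[ℝ] ℝ) :
    convexHull ℝ (faceSet T l) = {x ∈ convexHull ℝ T | ∀ y ∈ convexHull ℝ T, l y ≤ l x} := by
  rcases T.eq_empty_or_nonempty with rfl | hne
  · simp [faceSet]
  obtain ⟨t, ht⟩ := faceSet_nonempty hT hne l
  have htop : ∀ s ∈ T, l s ≤ l t := ht.2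
  ext x
  constructor
  · intro hx
    refine ⟨convexHull_mono (faceSet_subset T l) hx, fun y hy => ?_⟩
    have h1 : l y ≤ l t := le_of_mem_convexHull htop hy
    have h2 : -l x ≤ -l t := le_of_mem_convexHull (l := -l) (fun s hs => by
      rw [faceSet_eq_of_mem ht] at hs
      simp [hs.2]) hx
    linarith
  · rintro ⟨hx, hmax⟩
    rw [faceSet_eq_of_mem ht]
    exact mem_convexHull_of_apply_eq htop hx
      (le_antisymm (le_of_mem_convexHull htop hx) (hmax t (subset_convexHull ℝ T ht.1)))

theorem convexHull_faceSet_inter {T : Set E} (hT : T.Finite) (l : E →ₗ[ℝ] ℝ) :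
    convexHull ℝ (faceSet T l) ∩ T = faceSet T l := by
  refine Set.Subset.antisymm ?_ fun t ht => ⟨subset_convexHull ℝ _ ht, ht.1⟩
  rintro t ⟨h1, h2⟩
  rw [convexHull_faceSet T hT] at h1
  exact ⟨h2, fun s hs => h1.2 s (subset_convexHull ℝ _ hs)⟩

/-- Functionals such that one vanishes on the kernel of the other are proportional. -/
theorem exists_eq_smul_of_ker_le {l l' : E →ₗ[ℝ] ℝ} (h : LinearMap.ker l ≤ LinearMap.ker l') :
    ∃ t : ℝ, l' = t • l := by
  have := mem_span_of_iInf_ker_le_ker (ι := Unit) (L := fun _ => l) (K := l') (by simpa using h)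
  rw [Set.range_const, Submodule.mem_span_singleton] at this
  obtain ⟨t, ht⟩ := this
  exact ⟨t, ht.symm⟩

variable [FiniteDimensional ℝ E]

theorem finrank_vectorSpan_faceSet_lt {T : Set E} {l : E →ₗ[ℝ] ℝ} (hT : T.Finite)
    (h : faceSet T l ≠ T) :
    Module.finrank ℝ (vectorSpan ℝ (faceSet T l)) < Module.finrank ℝ (vectorSpan ℝ T) := by
  refine Submodule.finrank_lt_finrank_of_lt
    (lt_of_le_of_ne (vectorSpan_mono ℝ (faceSet_subset T l)) fun heq => h ?_)
  refine (faceSet_subset T l).antisymm fun t ht => ?_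
  obtain ⟨x, hx⟩ := faceSet_nonempty hT ⟨t, ht⟩ l
  have h1 : t -ᵥ x ∈ vectorSpan ℝ T := vsub_mem_vectorSpan ℝ ht hx.1
  rw [← heq] at h1
  have h2 := vectorSpan_faceSet_le_ker T l h1
  rw [LinearMap.mem_ker, vsub_eq_sub, map_sub, sub_eq_zero] at h2
  rw [faceSet_eq_of_mem hx]
  exact ⟨ht, h2⟩

/-- A proper face of codimension at least two is not maximal: tilting its supporting functional
about it, until another point of `T` is hit, gives a larger proper face. -/
theorem exists_larger_faceSet {T : Set E} {l : E →ₗ[ℝ] ℝ} (hT : T.Finite) (h : faceSet T l ≠ T)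
    (hdim : Module.finrank ℝ (vectorSpan ℝ (faceSet T l)) + 1 <
      Module.finrank ℝ (vectorSpan ℝ T)) :
    ∃ l' : E →ₗ[ℝ] ℝ, faceSet T l ⊂ faceSet T l' ∧ faceSet T l' ≠ T := by
  obtain ⟨y, hyT, hyF⟩ : ∃ y ∈ T, y ∉ faceSet T l := by
    by_contra! hcon
    exact h ((faceSet_subset T l).antisymm hcon)
  obtain ⟨x, hx⟩ := faceSet_nonempty hT ⟨y, hyT⟩ l
  have hlt : ∀ t ∈ T, t ∉ faceSet T l → l t < l x := by
    intro t ht htF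
    refine lt_of_le_of_ne (hx.2 t ht) fun heq => htF ?_
    rw [faceSet_eq_of_mem hx]
    exact ⟨ht, heq⟩
  set W := vectorSpan ℝ (faceSet T l) ⊔ Submodule.span ℝ {y - x} with hW
  have hWdim : Module.finrank ℝ W < Module.finrank ℝ (vectorSpan ℝ T) := by
    have h1 := Submodule.finrank_add_le_finrank_add_finrank (vectorSpan ℝ (faceSet T l))
      (Submodule.span ℝ {y - x})
    have h2 := finrank_span_le_card (R := ℝ) ({y - x} : Set E)
    rw [← hW] at h1
    rw [Set.toFinset_singleton, Finset.card_singleton] at h2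
    omega
  obtain ⟨z, hzT, hz⟩ : ∃ z ∈ T, z - x ∉ W := by
    by_contra! hcon
    exact absurd (Submodule.finrank_mono (vectorSpan_le_of_forall_sub_mem hx.1 hcon)) (by omega)
  obtain ⟨g, hgz, hgW⟩ : ∃ g : E →ₗ[ℝ] ℝ, 0 < g (z - x) ∧ W ≤ LinearMap.ker g := by
    obtain ⟨g, h1, h2⟩ := Submodule.exists_le_ker_of_notMem hz
    rcases h1.lt_or_gt with h1 | h1
    · refine ⟨-g, by simpa using h1, fun w hw => ?_⟩
      have := h2 hw
      simp_all
    · exact ⟨g, h1, h2⟩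
  have hgF : ∀ t ∈ faceSet T l, g t = g x := by
    intro t ht
    have := hgW (Submodule.mem_sup_left (vsub_mem_vectorSpan ℝ ht hx))
    rwa [LinearMap.mem_ker, vsub_eq_sub, map_sub, sub_eq_zero] at this
  have hgy : g y = g x := by
    have := hgW (Submodule.mem_sup_right (Submodule.mem_span_singleton_self (y - x)))
    rwa [LinearMap.mem_ker, map_sub, sub_eq_zero] at this
  rw [map_sub, sub_pos] at hgz
  -- The tilt at which the first further point is hit.
  obtain ⟨w, ⟨hwT, hwg⟩, hwmin⟩ := Set.exists_min_image {t ∈ T | g x < g t}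
    (fun t => (l x - l t) / (g t - g x)) (hT.subset fun _ h => h.1) ⟨z, hzT, hgz⟩
  set τ := (l x - l w) / (g w - g x) with hτ
  have hwx : l w ≤ l x := hx.2 w hwT
  have hτ0 : 0 ≤ τ := div_nonneg (by linarith) (by linarith)
  have hle : ∀ t ∈ T, (l + τ • g) t ≤ (l + τ • g) x := by
    intro t ht
    simp only [LinearMap.add_apply, LinearMap.smul_apply, smul_eq_mul]
    by_cases hgt : g x < g t
    · have := hwmin t ⟨ht, hgt⟩
      rw [le_div_iff₀ (by linarith)] at this
      linarith
    · have := hx.2 t ht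
      nlinarith
  have hx' : x ∈ faceSet T (l + τ • g) := ⟨hx.1, hle⟩
  refine ⟨l + τ • g, ⟨?_, ?_⟩, ?_⟩
  · intro t ht
    rw [faceSet_eq_of_mem hx']
    refine ⟨ht.1, ?_⟩
    have h1 : l t = l x := by
      rw [faceSet_eq_of_mem hx] at ht
      exact ht.2
    simp [h1, hgF t ht]
  · intro hsub
    have hw' : w ∈ faceSet T (l + τ • g) := by
      rw [faceSet_eq_of_mem hx']
      refine ⟨hwT, ?_⟩
      have : τ * (g w - g x) = l x - l w := div_mul_cancel₀ _ (by linarith)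
      simp only [LinearMap.add_apply, LinearMap.smul_apply, smul_eq_mul]
      linarith
    exact absurd (hgF w (hsub hw')) hwg.ne'
  · intro heq
    have hy' : y ∈ faceSet T (l + τ • g) := by rwa [heq]
    rw [faceSet_eq_of_mem hx'] at hy'
    have h1 := hy'.2
    simp only [LinearMap.add_apply, LinearMap.smul_apply, smul_eq_mul, hgy] at h1
    exact absurd (hlt y hyT hyF) (by linarith)

/-- Every proper face is contained in a face of codimension one. -/
theorem exists_facet_faceSet {T : Set E} (hT : T.Finite) {l : E →ₗ[ℝ] ℝ} (h : faceSet T l ≠ T) :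
    ∃ l' : E →ₗ[ℝ] ℝ, faceSet T l ⊆ faceSet T l' ∧ faceSet T l' ≠ T ∧
      Module.finrank ℝ (vectorSpan ℝ (faceSet T l')) + 1 = Module.finrank ℝ (vectorSpan ℝ T) := by
  induction hn : T.ncard - (faceSet T l).ncard using Nat.strong_induction_on generalizing l with
  | _ n ih =>
    have h1 := finrank_vectorSpan_faceSet_lt hT h
    rcases Nat.lt_or_ge (Module.finrank ℝ (vectorSpan ℝ (faceSet T l)) + 1)
      (Module.finrank ℝ (vectorSpan ℝ T)) with h2 | h2
    · obtain ⟨l', hl, hl'⟩ := exists_larger_faceSet hT h h2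
      have h3 := Set.ncard_lt_ncard hl (hT.subset (faceSet_subset T l'))
      have h4 := Set.ncard_le_ncard (faceSet_subset T l') hT
      obtain ⟨l'', h5, h6⟩ := ih (T.ncard - (faceSet T l').ncard) (by omega) hl' rfl
      exact ⟨l'', hl.subset.trans h5, h6⟩
    · exact ⟨l, subset_rfl, h, by omega⟩

end Faces

/-! ### Counting the facets of the convex hull of a finite set -/

section Facets

variable {d : ℕ}

local notation "𝔼" => EuclideanSpace ℝ (Fin d)

theorem isFace_convexHull_faceSet {T : Set 𝔼} (hT : T.Finite) (hne : T.Nonempty)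
    (l : 𝔼 →ₗ[ℝ] ℝ) : IsFace (convexHull ℝ T) (convexHull ℝ (faceSet T l)) := by
  refine ⟨(faceSet_nonempty hT hne l).convexHull, fun _ => ⟨LinearMap.toContinuousLinearMap l, ?_⟩⟩
  rw [convexHull_faceSet T hT]
  rfl

theorem exists_faceSet_of_isFace {T F : Set 𝔼} (hT : T.Finite) (h : IsFace (convexHull ℝ T) F) :
    ∃ l : 𝔼 →ₗ[ℝ] ℝ, F = convexHull ℝ (faceSet T l) := by
  obtain ⟨l, hl⟩ := h.2 h.1
  refine ⟨l.toLinearMap, ?_⟩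
  rw [convexHull_faceSet T hT, hl]
  rfl

theorem finite_facets_convexHull {T : Set 𝔼} (hT : T.Finite) :
    (facets (convexHull ℝ T)).Finite := by
  refine (hT.finite_subsets.image (convexHull ℝ)).subset ?_
  rintro F ⟨hF, -⟩
  obtain ⟨l, rfl⟩ := exists_faceSet_of_isFace hT hF
  exact ⟨_, faceSet_subset T l, rfl⟩

theorem convexHull_faceSet_mem_facets {T : Set 𝔼} (hT : T.Finite) (hne : T.Nonempty)
    {l : 𝔼 →ₗ[ℝ] ℝ}
    (h : Module.finrank ℝ (vectorSpan ℝ (faceSet T l)) + 1 = Module.finrank ℝ (vectorSpan ℝ T)) :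
    convexHull ℝ (faceSet T l) ∈ facets (convexHull ℝ T) := by
  refine ⟨isFace_convexHull_faceSet hT hne l, ?_⟩
  rw [polyDim, polyDim, vectorSpan_convexHull, vectorSpan_convexHull]
  exact h

/-- A polytope of positive dimension has at least two facets: a facet containing the points where a
functional supporting another facet is minimal is different from that facet. -/
theorem two_le_ncard_facets {T : Set 𝔼} (hT : T.Finite)
    (hdim : Module.finrank ℝ (vectorSpan ℝ T) ≠ 0) :
    2 ≤ (facets (convexHull ℝ T)).ncard := by
  have hnt : vectorSpan ℝ T ≠ ⊥ := fun h => hdim (by rw [h, finrank_bot])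
  have hne : T.Nonempty := by
    rw [Set.nonempty_iff_ne_empty]
    rintro rfl
    simp at hnt
  obtain ⟨x, hx⟩ := hne
  obtain ⟨y, hy, hyx⟩ : ∃ y ∈ T, y - x ≠ 0 := by
    by_contra! hcon
    exact hnt (le_bot_iff.1 (vectorSpan_le_of_forall_sub_mem hx fun t ht => by simp [hcon t ht]))
  obtain ⟨l, hl, -⟩ := Submodule.exists_le_ker_of_notMem (p := (⊥ : Submodule ℝ 𝔼))
    (v := y - x) (by simpa using hyx)
  have hproper : faceSet T l ≠ T := by
    intro h
    have h1 := vsub_mem_vectorSpan ℝ hy hx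
    rw [← h] at h1
    exact hl (vectorSpan_faceSet_le_ker T l h1)
  obtain ⟨l₁, -, hl₁, hdim₁⟩ := exists_facet_faceSet hT hproper
  have key : ∀ t ∈ faceSet T l₁, t ∉ faceSet T (-l₁) := by
    intro t ht ht'
    refine hl₁ ((faceSet_subset T l₁).antisymm fun s hs => ⟨hs, fun r hr => ?_⟩)
    have h1 := ht.2 r hr
    have h2 := ht'.2 s hs
    simp only [LinearMap.neg_apply] at h2
    linarith
  obtain ⟨a, ha⟩ := faceSet_nonempty hT ⟨x, hx⟩ l₁
  obtain ⟨b, hb⟩ := faceSet_nonempty hT ⟨x, hx⟩ (-l₁)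
  obtain ⟨l₂, hsub, hl₂, hdim₂⟩ := exists_facet_faceSet hT (l := -l₁)
    (fun h => key a ha (by rw [h]; exact ha.1))
  have hdiff : convexHull ℝ (faceSet T l₁) ≠ convexHull ℝ (faceSet T l₂) := by
    intro h
    have h1 := congrArg (· ∩ T) h
    simp only [convexHull_faceSet_inter hT] at h1
    exact key b (h1 ▸ hsub hb) hb
  have hfin := finite_facets_convexHull hT
  rw [← Set.ncard_pair hdiff]
  refine Set.ncard_le_ncard ?_ hfin
  rintro _ (rfl | rfl)
  · exact convexHull_faceSet_mem_facets hT ⟨x, hx⟩ hdim₁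
  · exact convexHull_faceSet_mem_facets hT ⟨x, hx⟩ hdim₂

theorem vectorSpan_faceSet_eq_ker {T : Set 𝔼} {l : 𝔼 →ₗ[ℝ] ℝ} (hl : l ≠ 0)
    (hdim : Module.finrank ℝ (vectorSpan ℝ (faceSet T l)) + 1 = d) :
    vectorSpan ℝ (faceSet T l) = LinearMap.ker l := by
  refine Submodule.eq_of_le_of_finrank_eq (vectorSpan_faceSet_le_ker T l) ?_
  have h1 := Module.Dual.finrank_ker_add_one_of_ne_zero hl
  rw [finrank_euclideanSpace_fin] at h1
  omega

/-- Functionals that expose faces of `T` of dimension `d - 1`, no two of them positively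
proportional, are at most as many as the facets of the convex hull of `T`. If the hull has full
dimension, they expose distinct facets. If it has dimension `d - 1`, all of them are proportional,
so that there are at most two. -/
theorem card_le_ncard_facets (hd : 2 ≤ d) {T : Set 𝔼} (hT : T.Finite) {κ : Type*} [Fintype κ]
    (l : κ → 𝔼 →ₗ[ℝ] ℝ) (hl : ∀ i, l i ≠ 0)
    (hdim : ∀ i, Module.finrank ℝ (vectorSpan ℝ (faceSet T (l i))) + 1 = d)
    (hpos : ∀ i j (t : ℝ), 0 < t → l i = t • l j → i = j) :
    Fintype.card κ ≤ (facets (convexHull ℝ T)).ncard := by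
  have hspan : ∀ i, vectorSpan ℝ (faceSet T (l i)) = LinearMap.ker (l i) := fun i =>
    vectorSpan_faceSet_eq_ker (hl i) (hdim i)
  rcases isEmpty_or_nonempty κ with hκ | ⟨⟨i₀⟩⟩
  · simp
  have hne : T.Nonempty := by
    rw [Set.nonempty_iff_ne_empty]
    rintro rfl
    have h1 := hdim i₀
    have h2 : faceSet (∅ : Set 𝔼) (l i₀) = ∅ := Set.subset_empty_iff.1 (faceSet_subset _ _)
    rw [h2, vectorSpan_empty, finrank_bot] at h1
    omega
  by_cases hfull : vectorSpan ℝ T = ⊤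
  · have hTd : Module.finrank ℝ (vectorSpan ℝ T) = d := by
      rw [hfull, finrank_top, finrank_euclideanSpace_fin]
    let f : κ → facets (convexHull ℝ T) := fun i => ⟨convexHull ℝ (faceSet T (l i)),
      convexHull_faceSet_mem_facets hT hne ((hdim i).trans hTd.symm)⟩
    have hf : Function.Injective f := by
      intro i j hij
      have h1 : convexHull ℝ (faceSet T (l i)) = convexHull ℝ (faceSet T (l j)) :=
        congrArg Subtype.val hij
      have h2 := congrArg (· ∩ T) h1
      simp only [convexHull_faceSet_inter hT] at h2
      obtain ⟨t, ht⟩ := exists_eq_smul_of_ker_le (l := l j) (l' := l i)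
        (by rw [← hspan, ← hspan, h2])
      rcases lt_trichotomy t 0 with h | h | h
      · -- Both functionals are then constant on `T`.
        exfalso
        obtain ⟨x, hx⟩ := faceSet_nonempty hT hne (l i)
        have hx' := h2 ▸ hx
        have h3 : vectorSpan ℝ T ≤ LinearMap.ker (l j) := by
          refine vectorSpan_le_of_forall_sub_mem hx.1 fun s hs => ?_
          have h4 := hx.2 s hs
          have h5 := hx'.2 s hs
          rw [ht] at h4
          simp only [LinearMap.smul_apply, smul_eq_mul] at h4
          have h6 : l j x ≤ l j s := by nlinarith
          simp only [LinearMap.mem_ker, map_sub]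
          linarith
        rw [hfull, top_le_iff, LinearMap.ker_eq_top] at h3
        exact hl j h3
      · exact absurd (by rw [ht, h, zero_smul]) (hl i)
      · exact hpos i j t h ht
    have hfin := finite_facets_convexHull hT
    rw [← Nat.card_eq_fintype_card, ← Nat.card_coe_set_eq]
    have : Finite (facets (convexHull ℝ T)) := hfin
    exact Nat.card_le_card_of_injective f hf
  · have hlt : Module.finrank ℝ (vectorSpan ℝ T) < d := by
      have := Submodule.finrank_lt (lt_top_iff_ne_top.2 hfull).ne
      rwa [finrank_euclideanSpace_fin] at this
    have hT' : ∀ i, LinearMap.ker (l i) = vectorSpan ℝ T := by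
      intro i
      rw [← hspan]
      refine Submodule.eq_of_le_of_finrank_le (vectorSpan_mono ℝ (faceSet_subset T _)) ?_
      have := hdim i
      omega
    have hprop : ∀ i, ∃ t : ℝ, l i = t • l i₀ := fun i =>
      exists_eq_smul_of_ker_le (by rw [hT', hT'])
    choose t ht using hprop
    have ht0 : ∀ i, t i ≠ 0 := fun i h => hl i (by rw [ht, h, zero_smul])
    have hinj : Function.Injective fun i => decide (0 < t i) := by
      intro i j hij
      have hij' : 0 < t i ↔ 0 < t j := by simpa using hij
      have hq : 0 < t i / t j := by
        rcases (ht0 i).lt_or_gt with h | h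
        · have : t j < 0 := lt_of_le_of_ne (not_lt.1 (mt hij'.2 h.not_gt)) (ht0 j)
          exact div_pos_of_neg_of_neg h this
        · exact div_pos h (hij'.1 h)
      refine hpos i j _ hq ?_
      rw [ht i, ht j, smul_smul, div_mul_cancel₀ _ (ht0 j)]
    have hcard := Fintype.card_le_of_injective _ hinj
    rw [Fintype.card_bool] at hcard
    refine hcard.trans (two_le_ncard_facets hT ?_)
    have h1 := hdim i₀
    rw [hspan, hT'] at h1
    omega

end Facets

/-! ### Vertices, edges and the simplex principle -/

section Polytope

variable {d : ℕ}

local notation "𝔼" => EuclideanSpace ℝ (Fin d)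

theorem finite_vertices_convexHull {T : Set 𝔼} (hT : T.Finite) :
    (vertices (convexHull ℝ T)).Finite :=
  hT.subset extremePoints_convexHull_subset

theorem convexHull_vertices_convexHull {T : Set 𝔼} (hT : T.Finite) :
    convexHull ℝ (vertices (convexHull ℝ T)) = convexHull ℝ T := by
  have h := closure_convexHull_extremePoints (hT.isCompact_convexHull ℝ) (convex_convexHull ℝ T)
  rw [(Set.Finite.isClosed_convexHull ℝ (s := Set.extremePoints ℝ (convexHull ℝ T))
    (finite_vertices_convexHull hT)).closure_eq] at h
  exact h

theorem exists_lt_of_mem_vertices {T : Set 𝔼} (hT : T.Finite) {v : 𝔼}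
    (hv : v ∈ vertices (convexHull ℝ T)) :
    ∃ g : 𝔼 →ₗ[ℝ] ℝ, ∀ t ∈ T, t ≠ v → g v < g t := by
  have h1 := ((convex_convexHull ℝ T).mem_extremePoints_iff_mem_sdiff_convexHull_sdiff.1 hv).2
  have h2 : v ∉ convexHull ℝ (T \ {v}) := fun h =>
    h1 (convexHull_mono (Set.sdiff_subset_sdiff_left (subset_convexHull ℝ T)) h)
  obtain ⟨f, c, hfv, hf⟩ := geometric_hahn_banach_point_closed (convex_convexHull ℝ (T \ {v}))
    ((hT.subset Set.sdiff_subset).isClosed_convexHull ℝ) h2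
  exact ⟨f.toLinearMap, fun t ht htv => hfv.trans (hf t (subset_convexHull ℝ _ ⟨ht, htv⟩))⟩

/-- The neighbours of a vertex `v` of `P`: the vertices joined to `v` by an edge. -/
def nbrSet (P : Set 𝔼) (v : 𝔼) : Set 𝔼 :=
  {u | u ∈ vertices P ∧ u ≠ v ∧ IsExposed ℝ P (segment ℝ v u)}

theorem nbrSet_symm {P : Set 𝔼} {u v : 𝔼} (hv : v ∈ vertices P) (h : u ∈ nbrSet P v) :
    v ∈ nbrSet P u :=
  ⟨hv, h.2.1.symm, segment_symm ℝ v u ▸ h.2.2⟩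

theorem finrank_vectorSpan_segment {v u : 𝔼} (h : u ≠ v) :
    Module.finrank ℝ (vectorSpan ℝ (segment ℝ v u)) = 1 := by
  rw [← convexHull_pair, vectorSpan_convexHull, vectorSpan_pair]
  exact finrank_span_singleton (by rwa [vsub_eq_sub, sub_ne_zero, ne_comm])

theorem segment_mem_edges {P : Set 𝔼} {u v : 𝔼} (h : u ∈ nbrSet P v) :
    segment ℝ v u ∈ edges P :=
  ⟨⟨⟨v, left_mem_segment ℝ v u⟩, h.2.2⟩, finrank_vectorSpan_segment h.2.1⟩

/-- Two vertices in the same direction from a vertex coincide. -/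
theorem eq_of_sub_eq_smul {P : Set 𝔼} {v u w : 𝔼} (hv : v ∈ vertices P) (hu : u ∈ vertices P)
    (hw : w ∈ vertices P) (huv : u ≠ v) (hwv : w ≠ v) {t : ℝ} (ht : 0 < t)
    (h : w - v = t • (u - v)) : w = u := by
  have hseg : ∀ {a b : 𝔼} {s : ℝ}, a ∈ vertices P → b ∈ vertices P → a ≠ v → 0 < s → s < 1 →
      a - v = s • (b - v) → False := by
    intro a b s ha hb hav hs hs1 hab
    have hmem : a ∈ openSegment ℝ v b := by
      rw [openSegment_eq_image']
      exact ⟨s, ⟨hs, hs1⟩, by simp only [← hab, add_sub_cancel]⟩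
    exact hav ((mem_extremePoints.1 ha).2 v (extremePoints_subset hv) b
      (extremePoints_subset hb) hmem).1.symm
  rcases lt_trichotomy t 1 with h1 | h1 | h1
  · exact (hseg hw hu hwv ht h1 h).elim
  · rw [h1, one_smul] at h
    exact sub_left_inj.1 h
  · refine (hseg hu hw huv (inv_pos.2 ht) (inv_lt_one_of_one_lt₀ h1) ?_).elim
    rw [h, smul_smul, inv_mul_cancel₀ ht.ne', one_smul]

/-- The principle behind the simplex method: a vertex at which a linear functional is minimal among
the neighbours is a global minimum. Scale the differences to `v` of the other vertices so that they
lie in a hyperplane; the extreme points of their hull, which determine the sign of the functional,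
point along the edges at `v`. -/
theorem le_of_forall_nbrSet_le {P : Set 𝔼} (hP : IsPolytope P) {v : 𝔼} (hv : v ∈ vertices P)
    {g : 𝔼 →ₗ[ℝ] ℝ} (hg : ∀ u ∈ nbrSet P v, g v ≤ g u) {x : 𝔼} (hx : x ∈ P) : g v ≤ g x := by
  obtain ⟨S, hS, rfl⟩ := hP
  set V := vertices (convexHull ℝ S) with hV
  have hVfin : V.Finite := finite_vertices_convexHull hS
  have hVhull : convexHull ℝ V = convexHull ℝ S := convexHull_vertices_convexHull hS
  have hv' : v ∈ vertices (convexHull ℝ V) := by rwa [hVhull]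
  obtain ⟨l, hl⟩ := exists_lt_of_mem_vertices hVfin hv'
  suffices hvert : ∀ w ∈ V, w ≠ v → 0 ≤ g (w - v) by
    rw [← hVhull] at hx
    have h1 : (-g) x ≤ -g v := le_of_mem_convexHull (l := -g) (fun w hw => by
      by_cases hwv : w = v
      · simp [hwv]
      · have := hvert w hw hwv
        rw [map_sub] at this
        simp only [LinearMap.neg_apply]
        linarith) hx
    simp only [LinearMap.neg_apply] at h1
    linarith
  let δ : 𝔼 → 𝔼 := fun w => (l w - l v)⁻¹ • (w - v)
  set D : Set 𝔼 := δ '' (V \ {v}) with hD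
  have hDfin : D.Finite := (hVfin.subset Set.sdiff_subset).image δ
  have hsc : ∀ w ∈ V, w ≠ v → w - v = (l w - l v) • δ w := by
    intro w hw hwv
    have := hl w hw hwv
    simp only [δ]
    rw [smul_smul, mul_inv_cancel₀ (by linarith), one_smul]
  have hlδ : ∀ w ∈ V, w ≠ v → l (δ w) = 1 := by
    intro w hw hwv
    have := hl w hw hwv
    simp only [δ, map_smul, map_sub, smul_eq_mul]
    exact inv_mul_cancel₀ (by linarith)
  -- Extreme points of the hull of the scaled differences point along edges.
  have hext : ∀ e ∈ vertices (convexHull ℝ D), 0 ≤ g e := by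
    intro e he
    obtain ⟨u, ⟨huV, huv⟩, rfl⟩ : e ∈ D := extremePoints_convexHull_subset he
    have huv' : u ≠ v := huv
    obtain ⟨f, hf⟩ := exists_lt_of_mem_vertices hDfin he
    let h : 𝔼 →ₗ[ℝ] ℝ := f (δ u) • l - f
    have hval : ∀ w ∈ V, w ≠ v → h w - h v = (l w - l v) * (f (δ u) - f (δ w)) := by
      intro w hw hwv
      rw [← map_sub, hsc w hw hwv]
      simp only [h, LinearMap.sub_apply, LinearMap.smul_apply, map_smul, smul_eq_mul,
        hlδ w hw hwv]
      ring
    have hneg : ∀ w ∈ V, w ≠ v → w ≠ u → h w < h v := by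
      intro w hw hwv hwu
      have h1 := hl w hw hwv
      have h2 := hl u huV huv'
      have h3 : f (δ u) < f (δ w) := by
        refine hf (δ w) ⟨w, ⟨hw, hwv⟩, rfl⟩ fun heq => hwu ?_
        refine eq_of_sub_eq_smul hv huV hw huv' hwv
          (t := (l w - l v) * (l u - l v)⁻¹) (by
            have : 0 < l w - l v := by linarith
            have : 0 < l u - l v := by linarith
            positivity) ?_
        rw [hsc w hw hwv, heq, mul_smul]
      have := hval w hw hwv
      nlinarith
    have hu0 : h u = h v := by
      have := hval u huV huv'
      rw [sub_self, mul_zero] at this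
      linarith
    have hface : faceSet V h = {v, u} := by
      have hvf : v ∈ faceSet V h := by
        refine ⟨hv, fun w hw => ?_⟩
        by_cases hwv : w = v
        · rw [hwv]
        · by_cases hwu : w = u
          · rw [hwu, hu0]
          · exact (hneg w hw hwv hwu).le
      rw [faceSet_eq_of_mem hvf]
      ext w
      simp only [Set.mem_ofPred_eq, Set.mem_insert_iff, Set.mem_singleton_iff]
      constructor
      · rintro ⟨hw, hwh⟩
        by_contra! hcon
        exact (hneg w hw hcon.1 hcon.2).ne hwh
      · rintro (rfl | rfl)
        · exact ⟨hv, rfl⟩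
        · exact ⟨huV, hu0⟩
    have hunbr : u ∈ nbrSet (convexHull ℝ S) v := by
      refine ⟨huV, huv', ?_⟩
      have h1 := (isFace_convexHull_faceSet hVfin ⟨v, hv⟩ h).2
      rwa [hface, convexHull_pair, hVhull] at h1
    have h1 := hg u hunbr
    have h2 := hl u huV huv'
    simp only [δ, map_smul, map_sub, smul_eq_mul]
    exact mul_nonneg (inv_nonneg.2 (by linarith)) (by linarith)
  intro w hw hwv
  have hmem : δ w ∈ convexHull ℝ (vertices (convexHull ℝ D)) := by
    rw [convexHull_vertices_convexHull hDfin]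
    exact subset_convexHull ℝ _ ⟨w, ⟨hw, hwv⟩, rfl⟩
  have h1 : (-g) (δ w) ≤ 0 := le_of_mem_convexHull (l := -g) (fun e he => by
    have := hext e he
    simpa using this) hmem
  simp only [LinearMap.neg_apply] at h1
  rw [hsc w hw hwv, map_smul, smul_eq_mul]
  have := hl w hw hwv
  exact mul_nonneg (by linarith) (by linarith)

/-! ### The local structure of a simple polytope -/

theorem IsPolytope.finite_vertices {P : Set 𝔼} (hP : IsPolytope P) : (vertices P).Finite := by
  obtain ⟨S, hS, rfl⟩ := hP
  exact finite_vertices_convexHull hS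

theorem IsPolytope.convexHull_vertices {P : Set 𝔼} (hP : IsPolytope P) :
    convexHull ℝ (vertices P) = P := by
  obtain ⟨S, hS, rfl⟩ := hP
  exact convexHull_vertices_convexHull hS

theorem IsSimplePolytope.vectorSpan_eq_top {P : Set 𝔼} (hP : IsSimplePolytope P) :
    vectorSpan ℝ P = ⊤ :=
  Submodule.eq_top_of_finrank_eq (by rw [finrank_euclideanSpace_fin]; exact hP.2.1)

theorem IsSimplePolytope.vectorSpan_vertices {P : Set 𝔼} (hP : IsSimplePolytope P) :
    vectorSpan ℝ (vertices P) = ⊤ := by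
  rw [← vectorSpan_convexHull, hP.1.convexHull_vertices, hP.vectorSpan_eq_top]

theorem IsPolytope.finite_nbrSet {P : Set 𝔼} (hP : IsPolytope P) (v : 𝔼) :
    (nbrSet P v).Finite :=
  hP.finite_vertices.subset fun _ h => h.1

theorem IsSimplePolytope.ncard_nbrSet_le {P : Set 𝔼} (hP : IsSimplePolytope P) (hd : d ≠ 0)
    {v : 𝔼} (hv : v ∈ vertices P) : (nbrSet P v).ncard ≤ d := by
  have h := hP.2.2 v hv
  have hfin : {F ∈ edges P | v ∈ F}.Finite := Set.finite_of_ncard_ne_zero (by rwa [h])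
  refine (Set.ncard_le_ncard_of_injOn (t := {F ∈ edges P | v ∈ F}) (fun u => segment ℝ v u)
    (fun u hu => ⟨segment_mem_edges hu, left_mem_segment ℝ v u⟩) ?_ hfin).trans h.le
  intro u hu u' hu' heq
  have h1 : u ∈ segment ℝ v u' := by
    have : segment ℝ v u = segment ℝ v u' := heq
    exact this ▸ right_mem_segment ℝ v u
  rcases (mem_extremePoints_iff_forall_segment.1 hu.1).2 v (extremePoints_subset hv) u'
    (extremePoints_subset hu'.1) h1 with h2 | h2
  · exact absurd h2.symm hu.2.1
  · exact h2.symm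

/-- By the simplex principle, a functional that is constant on `v` and its neighbours is constant on
`P`, so the differences of the neighbours span the whole space. -/
theorem IsSimplePolytope.span_nbrSet {P : Set 𝔼} (hP : IsSimplePolytope P) {v : 𝔼}
    (hv : v ∈ vertices P) :
    Submodule.span ℝ (Set.range fun u : nbrSet P v => (u : 𝔼) - v) = ⊤ := by
  by_contra hne
  obtain ⟨f, hf, hker⟩ := Submodule.exists_le_ker_of_lt_top _ (lt_top_iff_ne_top.2 hne)
  have h0 : ∀ u ∈ nbrSet P v, f u = f v := by
    intro u hu
    have := hker (Submodule.subset_span ⟨⟨u, hu⟩, rfl⟩)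
    rwa [LinearMap.mem_ker, map_sub, sub_eq_zero] at this
  have hconst : vectorSpan ℝ P ≤ LinearMap.ker f := by
    refine vectorSpan_le_of_forall_sub_mem (extremePoints_subset hv) fun x hx => ?_
    have h1 := le_of_forall_nbrSet_le hP.1 hv (g := f) (fun u hu => (h0 u hu).ge) hx
    have h2 := le_of_forall_nbrSet_le hP.1 hv (g := -f) (fun u hu => by simp [h0 u hu]) hx
    simp only [LinearMap.neg_apply] at h2
    rw [LinearMap.mem_ker, map_sub]
    linarith
  rw [hP.vectorSpan_eq_top, top_le_iff, LinearMap.ker_eq_top] at hconst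
  exact hf hconst

theorem IsSimplePolytope.ncard_nbrSet {P : Set 𝔼} (hP : IsSimplePolytope P) (hd : d ≠ 0)
    {v : 𝔼} (hv : v ∈ vertices P) : (nbrSet P v).ncard = d := by
  refine le_antisymm (hP.ncard_nbrSet_le hd hv) ?_
  have := (hP.1.finite_nbrSet v).fintype
  have h1 := finrank_range_le_card (R := ℝ) (fun u : nbrSet P v => (u : 𝔼) - v)
  rw [Set.finrank, hP.span_nbrSet hv, finrank_top, finrank_euclideanSpace_fin] at h1
  rwa [← Nat.card_coe_set_eq, Nat.card_eq_fintype_card]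

/-- The differences to a vertex `v` of its neighbours form a basis, and `P` lies in the orthant with
apex `v` that they span. -/
theorem IsSimplePolytope.exists_basis {P : Set 𝔼} (hP : IsSimplePolytope P) (hd : d ≠ 0)
    {v : 𝔼} (hv : v ∈ vertices P) :
    ∃ b : Module.Basis (nbrSet P v) ℝ 𝔼, (∀ u, b u = (u : 𝔼) - v) ∧
      ∀ x ∈ P, ∀ u, 0 ≤ b.repr (x - v) u := by
  have := (hP.1.finite_nbrSet v).fintype
  let b := basisOfTopLeSpanOfCardEqFinrank (fun u : nbrSet P v => (u : 𝔼) - v)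
    (hP.span_nbrSet hv).ge (by
      rw [finrank_euclideanSpace_fin, ← Nat.card_eq_fintype_card, Nat.card_coe_set_eq,
        hP.ncard_nbrSet hd hv])
  have hb : ∀ u, b u = (u : 𝔼) - v := fun u => by
    simp [b, coe_basisOfTopLeSpanOfCardEqFinrank]
  refine ⟨b, hb, fun x hx u => ?_⟩
  have h1 := le_of_forall_nbrSet_le hP.1 hv (g := b.coord u) (fun u' hu' => by
    rw [← sub_nonneg, ← map_sub, ← hb ⟨u', hu'⟩, Module.Basis.coord_apply,
      Module.Basis.repr_self_apply]
    split_ifs <;> norm_num) hx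
  rw [← sub_nonneg, ← map_sub] at h1
  exact h1

/-- The functional that takes the value `1` at the differences to `v` of its neighbours is at least
`1` at the differences of all other vertices: beyond the hyperplane through the neighbours, `v` is
the only vertex. -/
theorem IsSimplePolytope.exists_cutFunctional {P : Set 𝔼} (hP : IsSimplePolytope P) (hd : d ≠ 0)
    {v : 𝔼} (hv : v ∈ vertices P) :
    ∃ k : 𝔼 →ₗ[ℝ] ℝ, (∀ u ∈ nbrSet P v, k (u - v) = 1) ∧
      ∀ w ∈ vertices P, w ≠ v → 1 ≤ k (w - v) := by
  obtain ⟨b, hb, hpos⟩ := hP.exists_basis hd hv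
  have := (hP.1.finite_nbrSet v).fintype
  let k : 𝔼 →ₗ[ℝ] ℝ := ∑ u, b.coord u
  have hk : ∀ x, k x = ∑ u, b.repr x u := fun x => by simp [k]
  have hku : ∀ u ∈ nbrSet P v, k (u - v) = 1 := by
    intro u hu
    classical
    rw [hk, ← hb ⟨u, hu⟩]
    simp [Finsupp.single_apply]
  have hzero : ∀ w ∈ P, k (w - v) ≤ 0 → w = v := by
    intro w hw h
    rw [hk] at h
    have h0 := (Finset.sum_eq_zero_iff_of_nonneg fun u _ => hpos w hw u).1
      (le_antisymm h (Finset.sum_nonneg fun u _ => hpos w hw u))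
    have h1 : b.repr (w - v) = 0 := by
      ext u
      exact h0 u (Finset.mem_univ u)
    exact sub_eq_zero.1 ((LinearEquiv.map_eq_zero_iff _).1 h1)
  refine ⟨k, hku, fun w hw hwv => ?_⟩
  by_contra! hlt
  obtain ⟨m, ⟨hmV, hmv⟩, hmin⟩ := Set.exists_min_image (vertices P \ {v}) k
    (hP.1.finite_vertices.subset Set.sdiff_subset) ⟨w, hw, hwv⟩
  have hmw : k m ≤ k w := hmin w ⟨hw, hwv⟩
  have hmlt : k (m - v) < 1 := by
    rw [map_sub] at hlt ⊢
    linarith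
  -- A minimizer `m` below the hyperplane is not adjacent to `v`, hence a minimum over all of `P`.
  have hglob := le_of_forall_nbrSet_le hP.1 hmV (g := k) (fun u hu => by
    refine hmin u ⟨hu.1, ?_⟩
    rintro rfl
    exact hmlt.ne (hku m (nbrSet_symm hmV hu))) (extremePoints_subset hv)
  refine hmv (hzero m (extremePoints_subset hmV) ?_)
  rw [map_sub]
  linarith

end Polytope

/-! ### Facets through a vertex of a simple polytope -/

section SimplePolytope

variable {d : ℕ}

local notation "𝔼" => EuclideanSpace ℝ (Fin d)

theorem IsSimplePolytope.exists_facetFunctional {P : Set 𝔼} (hP : IsSimplePolytope P) {F : Set 𝔼}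
    (hF : F ∈ facets P) :
    ∃ l : 𝔼 →ₗ[ℝ] ℝ, F = convexHull ℝ (faceSet (vertices P) l) ∧ l ≠ 0 ∧
      Module.finrank ℝ (vectorSpan ℝ (faceSet (vertices P) l)) + 1 = d := by
  obtain ⟨hface, hdim⟩ := hF
  rw [← hP.1.convexHull_vertices] at hface
  obtain ⟨l, rfl⟩ := exists_faceSet_of_isFace hP.1.finite_vertices hface
  have h1 : Module.finrank ℝ (vectorSpan ℝ (faceSet (vertices P) l)) + 1 = d := by
    rw [hP.2.1, polyDim, vectorSpan_convexHull] at hdim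
    exact hdim
  refine ⟨l, rfl, ?_, h1⟩
  rintro rfl
  have h2 : faceSet (vertices P) (0 : 𝔼 →ₗ[ℝ] ℝ) = vertices P := by simp [faceSet]
  rw [h2, hP.vectorSpan_vertices, finrank_top, finrank_euclideanSpace_fin] at h1
  omega

/-- A face through a vertex `v` is spanned by `v` and the neighbours of `v` in the face: along the
face, the coordinates that belong to the other neighbours vanish. -/
theorem IsSimplePolytope.vectorSpan_faceSet_le {P : Set 𝔼} (hP : IsSimplePolytope P) (hd : d ≠ 0)
    {l : 𝔼 →ₗ[ℝ] ℝ} {v : 𝔼} (hv : v ∈ faceSet (vertices P) l) :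
    vectorSpan ℝ (faceSet (vertices P) l) ≤
      Submodule.span ℝ ((fun u => u - v) '' (nbrSet P v ∩ faceSet (vertices P) l)) := by
  obtain ⟨b, hb, hpos⟩ := hP.exists_basis hd hv.1
  have := (hP.1.finite_nbrSet v).fintype
  refine vectorSpan_le_of_forall_sub_mem hv fun t ht => ?_
  have hle : ∀ u : nbrSet P v, l (b u) ≤ 0 := by
    intro u
    have := hv.2 u u.2.1
    rw [hb, map_sub]
    linarith
  have hsum : ∑ u, b.repr (t - v) u * l (b u) = 0 := by
    have h1 := congrArg l (b.sum_repr (t - v))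
    rw [faceSet_eq_of_mem hv] at ht
    simp only [map_sum, map_smul, smul_eq_mul] at h1
    rw [h1, map_sub, ht.2, sub_self]
  have hterm := (Finset.sum_eq_zero_iff_of_nonpos fun u _ =>
    mul_nonpos_of_nonneg_of_nonpos (hpos t (extremePoints_subset ht.1) u) (hle u)).1 hsum
  rw [← b.sum_repr (t - v)]
  refine Submodule.sum_mem _ fun u hu => ?_
  rcases mul_eq_zero.1 (hterm u hu) with h | h
  · rw [h, zero_smul]
    exact Submodule.zero_mem _
  · refine Submodule.smul_mem _ _ (Submodule.subset_span ⟨u, ⟨u.2, ?_⟩, (hb u).symm⟩)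
    rw [faceSet_eq_of_mem hv]
    rw [hb, map_sub, sub_eq_zero] at h
    exact ⟨u.2.1, h⟩

theorem span_sub_le_vectorSpan {v : 𝔼} {X : Set 𝔼} :
    Submodule.span ℝ ((fun u => u - v) '' X) ≤ vectorSpan ℝ (insert v X) := by
  rw [Submodule.span_le]
  rintro _ ⟨u, hu, rfl⟩
  exact vsub_mem_vectorSpan ℝ (Set.mem_insert_of_mem v hu) (Set.mem_insert v X)

/-- A facet through `v` misses exactly one neighbour of `v`: at most one, since the others have to
span the facet, and at least one, since its functional would otherwise vanish on a basis. -/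
theorem IsSimplePolytope.ncard_nbrSet_diff_faceSet {P : Set 𝔼} (hP : IsSimplePolytope P)
    (hd : d ≠ 0) {l : 𝔼 →ₗ[ℝ] ℝ} (hl : l ≠ 0)
    (hdim : Module.finrank ℝ (vectorSpan ℝ (faceSet (vertices P) l)) + 1 = d) {v : 𝔼}
    (hv : v ∈ faceSet (vertices P) l) :
    (nbrSet P v \ faceSet (vertices P) l).ncard = 1 := by
  have hfin := hP.1.finite_nbrSet v
  have hN := hP.ncard_nbrSet hd hv.1
  have hsplit := Set.ncard_inter_add_ncard_sdiff_eq_ncard (nbrSet P v) (faceSet (vertices P) l) hfin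
  have h1 : d ≤ (nbrSet P v ∩ faceSet (vertices P) l).ncard + 1 := by
    have hle := Submodule.finrank_mono (hP.vectorSpan_faceSet_le hd hv)
    have hfin' : ((fun u => u - v) '' (nbrSet P v ∩ faceSet (vertices P) l)).Finite :=
      (hfin.subset Set.inter_subset_left).image _
    have := hfin'.fintype
    have h2 := finrank_span_le_card (R := ℝ)
      ((fun u => u - v) '' (nbrSet P v ∩ faceSet (vertices P) l))
    rw [← Set.ncard_eq_toFinset_card'] at h2
    have h3 := Set.ncard_image_le (f := fun u => u - v) (hfin.subset
      (Set.inter_subset_left (s := nbrSet P v) (t := faceSet (vertices P) l)))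
    omega
  have h4 : (nbrSet P v \ faceSet (vertices P) l).ncard ≠ 0 := by
    intro hempty
    rw [Set.ncard_eq_zero (hfin.subset Set.sdiff_subset), Set.sdiff_eq_empty] at hempty
    obtain ⟨b, hb, -⟩ := hP.exists_basis hd hv.1
    refine hl (b.ext fun u => ?_)
    have := hempty u.2
    rw [faceSet_eq_of_mem hv] at this
    rw [hb, map_sub, this.2, sub_self, LinearMap.zero_apply]
  omega

/-- A facet through a vertex `v` is determined by the neighbours of `v` that it contains. -/
theorem IsSimplePolytope.faceSet_eq {P : Set 𝔼} (hP : IsSimplePolytope P) (hd : d ≠ 0)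
    {l l' : 𝔼 →ₗ[ℝ] ℝ} (hl : l ≠ 0) (hl' : l' ≠ 0)
    (hdim : Module.finrank ℝ (vectorSpan ℝ (faceSet (vertices P) l)) + 1 = d)
    (hdim' : Module.finrank ℝ (vectorSpan ℝ (faceSet (vertices P) l')) + 1 = d) {v : 𝔼}
    (hv : v ∈ faceSet (vertices P) l) (hv' : v ∈ faceSet (vertices P) l')
    (hsub : nbrSet P v ∩ faceSet (vertices P) l ⊆ faceSet (vertices P) l') :
    faceSet (vertices P) l = faceSet (vertices P) l' := by
  have hle : vectorSpan ℝ (faceSet (vertices P) l) ≤ vectorSpan ℝ (faceSet (vertices P) l') :=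
    (hP.vectorSpan_faceSet_le hd hv).trans (span_sub_le_vectorSpan.trans
      (vectorSpan_mono ℝ (Set.insert_subset hv' hsub)))
  rw [vectorSpan_faceSet_eq_ker hl hdim, vectorSpan_faceSet_eq_ker hl' hdim'] at hle
  obtain ⟨t, rfl⟩ := exists_eq_smul_of_ker_le hle
  have ht0 : t ≠ 0 := by
    rintro rfl
    exact hl' (zero_smul ℝ l)
  obtain ⟨u, hu⟩ := Set.ncard_eq_one.1 (hP.ncard_nbrSet_diff_faceSet hd hl hdim hv)
  have hu' : u ∈ nbrSet P v \ faceSet (vertices P) l := by rw [hu]; rfl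
  have h1 : l u < l v := by
    refine lt_of_le_of_ne (hv.2 u hu'.1.1) fun h => hu'.2 ?_
    rw [faceSet_eq_of_mem hv]
    exact ⟨hu'.1.1, h⟩
  have h2 := hv'.2 u hu'.1.1
  simp only [LinearMap.smul_apply, smul_eq_mul] at h2
  have ht : 0 < t := lt_of_le_of_ne (by nlinarith) ht0.symm
  rw [faceSet_smul _ _ ht]

/-- The hyperplane through the neighbours of a vertex is spanned by them. -/
theorem IsSimplePolytope.le_finrank_vectorSpan_nbrSet {P : Set 𝔼} (hP : IsSimplePolytope P)
    (hd : d ≠ 0) {v : 𝔼} (hv : v ∈ vertices P) :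
    d ≤ Module.finrank ℝ (vectorSpan ℝ (nbrSet P v)) + 1 := by
  have hN := hP.ncard_nbrSet hd hv
  obtain ⟨u₀, hu₀⟩ : (nbrSet P v).Nonempty := Set.nonempty_of_ncard_ne_zero (by rwa [hN])
  have h1 : (⊤ : Submodule ℝ 𝔼) ≤ vectorSpan ℝ (nbrSet P v) ⊔ Submodule.span ℝ {u₀ - v} := by
    rw [← hP.span_nbrSet hv, Submodule.span_le]
    rintro _ ⟨u, rfl⟩
    have h2 : (u : 𝔼) - v = ((u : 𝔼) - u₀) + (u₀ - v) := by abel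
    simp only [h2]
    exact Submodule.add_mem_sup (vsub_mem_vectorSpan ℝ u.2 hu₀)
      (Submodule.mem_span_singleton_self _)
  have h3 := Submodule.finrank_mono h1
  rw [finrank_top, finrank_euclideanSpace_fin] at h3
  have h4 := Submodule.finrank_add_le_finrank_add_finrank (vectorSpan ℝ (nbrSet P v))
    (Submodule.span ℝ {u₀ - v})
  have h5 := finrank_span_le_card (R := ℝ) ({u₀ - v} : Set 𝔼)
  rw [Set.toFinset_singleton, Finset.card_singleton] at h5
  omega

/-! ### The incidence structure of a simple polytope and the facets of a sample -/

/-- The vertices of `P` that lie in `X`, as a finite set of elements of the vertex type. -/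
noncomputable def vertexFinset (P : Set 𝔼) [Fintype (vertices P)] (X : Set 𝔼) :
    Finset (vertices P) :=
  open Classical in Finset.univ.filter fun v => (v : 𝔼) ∈ X

theorem mem_vertexFinset {P : Set 𝔼} [Fintype (vertices P)] {X : Set 𝔼} {v : vertices P} :
    v ∈ vertexFinset P X ↔ (v : 𝔼) ∈ X := by
  simp [vertexFinset]

theorem card_vertexFinset {P : Set 𝔼} [Fintype (vertices P)] {X : Set 𝔼} (h : X ⊆ vertices P) :
    (vertexFinset P X).card = X.ncard := by
  rw [← Set.ncard_coe_finset, ← Set.ncard_image_of_injective _ Subtype.val_injective]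
  congr 1
  ext x
  simp only [Set.mem_image, Finset.mem_coe, mem_vertexFinset]
  exact ⟨fun ⟨v, hv, hvx⟩ => hvx ▸ hv, fun hx => ⟨⟨x, h hx⟩, hx, rfl⟩⟩

theorem IsSimplePolytope.mem_facet_iff {P : Set 𝔼} (hP : IsSimplePolytope P) {l : 𝔼 →ₗ[ℝ] ℝ}
    {v : 𝔼} (hv : v ∈ vertices P) :
    v ∈ convexHull ℝ (faceSet (vertices P) l) ↔ v ∈ faceSet (vertices P) l := by
  conv_rhs => rw [← convexHull_faceSet_inter hP.1.finite_vertices]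
  exact ⟨fun h => ⟨h, hv⟩, fun h => h.1⟩

open Classical in
/-- The vertex-facet incidences of a simple polytope. -/
noncomputable def simpleIncidence {P : Set 𝔼} [Fintype (vertices P)] (hP : IsSimplePolytope P)
    (hd : d ≠ 0) : SimpleIncidence (vertices P) (facets P) d where
  nbr v := vertexFinset P (nbrSet P v)
  inc F := vertexFinset P F
  card_nbr v := by
    rw [card_vertexFinset fun _ h => h.1, hP.ncard_nbrSet hd v.2]
  nbr_symm {u v} h := by
    rw [mem_vertexFinset] at h ⊢
    exact nbrSet_symm v.2 h
  notMem_nbr v h := (mem_vertexFinset.1 h).2.1 rfl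
  le_card_inc F := by
    obtain ⟨l, hF, hl, hdim⟩ := hP.exists_facetFunctional F.2
    have hVne : (vertices P).Nonempty := by
      rw [Set.nonempty_iff_ne_empty]
      intro h
      have := hP.vectorSpan_vertices
      rw [h, vectorSpan_empty] at this
      have h1 := congrArg (fun W : Submodule ℝ 𝔼 => Module.finrank ℝ W) this
      simp only [finrank_bot, finrank_top, finrank_euclideanSpace_fin] at h1
      exact hd h1.symm
    obtain ⟨v, hv⟩ := faceSet_nonempty hP.1.finite_vertices hVne l
    have h1 := hP.ncard_nbrSet_diff_faceSet hd hl hdim hv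
    have h2 := Set.ncard_inter_add_ncard_sdiff_eq_ncard (nbrSet P v) (faceSet (vertices P) l)
      (hP.1.finite_nbrSet v)
    rw [hP.ncard_nbrSet hd hv.1, h1] at h2
    have hfin : (faceSet (vertices P) l).Finite :=
      hP.1.finite_vertices.subset (faceSet_subset _ _)
    have h3 : (insert v (nbrSet P v ∩ faceSet (vertices P) l)).ncard ≤
        (faceSet (vertices P) l).ncard :=
      Set.ncard_le_ncard (Set.insert_subset hv Set.inter_subset_right) hfin
    rw [Set.ncard_insert_of_notMem (fun h => h.1.2.1 rfl) (hfin.subset Set.inter_subset_right),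
      h2] at h3
    have h4 : vertexFinset P F = vertexFinset P (faceSet (vertices P) l) := by
      ext w
      rw [mem_vertexFinset, mem_vertexFinset, hF, hP.mem_facet_iff w.2]
    rwa [h4, card_vertexFinset (faceSet_subset _ _)]
  card_missing {v F} hv := by
    obtain ⟨l, hF, hl, hdim⟩ := hP.exists_facetFunctional F.2
    rw [mem_vertexFinset, hF, hP.mem_facet_iff v.2] at hv
    rw [← hP.ncard_nbrSet_diff_faceSet hd hl hdim hv,
      ← card_vertexFinset (fun _ h => h.1.1)]
    congr 1
    ext w
    rw [Finset.mem_sdiff, mem_vertexFinset, mem_vertexFinset, mem_vertexFinset, hF,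
      hP.mem_facet_iff w.2, Set.mem_sdiff]
  inc_ext {v F F'} hv hv' h := by
    obtain ⟨l, hF, hl, hdim⟩ := hP.exists_facetFunctional F.2
    obtain ⟨l', hF', hl', hdim'⟩ := hP.exists_facetFunctional F'.2
    rw [mem_vertexFinset, hF, hP.mem_facet_iff v.2] at hv
    rw [mem_vertexFinset, hF', hP.mem_facet_iff v.2] at hv'
    refine Subtype.ext ?_
    rw [hF, hF', hP.faceSet_eq hd hl hl' hdim hdim' hv hv']
    rintro w ⟨hw, hwF⟩
    by_contra hwF'
    have h1 : (⟨w, hw.1⟩ : vertices P) ∈ vertexFinset P (nbrSet P v) \ vertexFinset P F' := by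
      rw [Finset.mem_sdiff, mem_vertexFinset, mem_vertexFinset, hF', hP.mem_facet_iff hw.1]
      exact ⟨hw, hwF'⟩
    rw [← h, Finset.mem_sdiff, mem_vertexFinset, mem_vertexFinset, hF, hP.mem_facet_iff hw.1] at h1
    exact h1.2 hwF

open Classical in
/-- The sampled polytope has at least as many facets as there are hit facets and cut vertices. The
functional of a hit facet is still maximal over the sample on a set of dimension `d - 1`, and so is
the negative of the cut functional of a cut vertex, at the neighbours of that vertex. The faces of
`P` itself that these functionals expose differ, so no two of them are positively proportional. -/
theorem card_hitFacets_add_card_cutVertices_le {P : Set 𝔼} [Fintype (vertices P)]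
    [Fintype (facets P)] (hP : IsSimplePolytope P) (hd : 2 ≤ d) (A : Finset (vertices P)) :
    ((simpleIncidence hP (by omega)).hitFacets A).card +
      ((simpleIncidence hP (by omega)).cutVertices A).card ≤
        numFacets P (A : Set (vertices P)) := by
  have hd0 : d ≠ 0 := by omega
  set I := simpleIncidence hP hd0 with hI
  set T : Set 𝔼 := (fun v : vertices P => (v : 𝔼)) '' (A : Set (vertices P)) with hT
  have hTV : T ⊆ vertices P := by
    rintro _ ⟨v, -, rfl⟩
    exact v.2
  have hTfin : T.Finite := hP.1.finite_vertices.subset hTV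
  have hTmem : ∀ {u : 𝔼} (hu : u ∈ vertices P), u ∈ T ↔ (⟨u, hu⟩ : vertices P) ∈ A := by
    intro u hu
    constructor
    · rintro ⟨v, hv, rfl⟩
      exact hv
    · exact fun h => ⟨_, h, rfl⟩
  choose f hfF hf0 hfdim using fun F : facets P => hP.exists_facetFunctional F.2
  choose k hk1 hk using fun v : vertices P => hP.exists_cutFunctional hd0 v.2
  have hk0 : ∀ v, k v ≠ 0 := by
    intro v h0
    obtain ⟨u, hu⟩ : (nbrSet P v).Nonempty :=
      Set.nonempty_of_ncard_ne_zero (by rwa [hP.ncard_nbrSet hd0 v.2])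
    have := hk1 v u hu
    rw [h0, LinearMap.zero_apply] at this
    norm_num at this
  have hker : ∀ {l : 𝔼 →ₗ[ℝ] ℝ}, l ≠ 0 →
      Module.finrank ℝ (vectorSpan ℝ (faceSet T l)) + 1 ≤ d := by
    intro l hl
    have h1 := Module.Dual.finrank_ker_add_one_of_ne_zero hl
    rw [finrank_euclideanSpace_fin] at h1
    have h2 := Submodule.finrank_mono (vectorSpan_faceSet_le_ker T l)
    omega
  have hhit : ∀ F ∈ I.hitFacets A,
      Module.finrank ℝ (vectorSpan ℝ (faceSet T (f F))) + 1 = d := by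
    intro F hF
    refine le_antisymm (hker (hf0 F)) ?_
    simp only [SimpleIncidence.hitFacets, Finset.mem_filter, Finset.mem_univ, true_and] at hF
    obtain ⟨v, hvF, hvA, hsub⟩ := hF
    have hv : (v : 𝔼) ∈ faceSet (vertices P) (f F) := by
      have := mem_vertexFinset.1 hvF
      rwa [hfF F, hP.mem_facet_iff v.2] at this
    have h1 : insert (v : 𝔼) (nbrSet P v ∩ faceSet (vertices P) (f F)) ⊆ faceSet T (f F) := by
      refine Set.insert_subset (mem_faceSet_of_subset hTV hv ⟨v, hvA, rfl⟩) ?_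
      rintro u ⟨hu, huF⟩
      refine mem_faceSet_of_subset hTV huF ((hTmem hu.1).2 (hsub ?_))
      refine Finset.mem_inter.2 ⟨mem_vertexFinset.2 hu, mem_vertexFinset.2 ?_⟩
      rwa [hfF F, hP.mem_facet_iff hu.1]
    have h2 := Submodule.finrank_mono ((hP.vectorSpan_faceSet_le hd0 hv).trans
      (span_sub_le_vectorSpan.trans (vectorSpan_mono ℝ h1)))
    have := hfdim F
    omega
  have hcut : ∀ v ∈ I.cutVertices A,
      Module.finrank ℝ (vectorSpan ℝ (faceSet T (-k v))) + 1 = d := by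
    intro v hv
    refine le_antisymm (hker (neg_ne_zero.2 (hk0 v))) ?_
    simp only [SimpleIncidence.cutVertices, Finset.mem_filter, Finset.mem_univ, true_and] at hv
    have h1 : nbrSet P v ⊆ faceSet T (-k v) := by
      intro u hu
      refine ⟨(hTmem hu.1).2 (hv.2 (mem_vertexFinset.2 hu)), fun s hs => ?_⟩
      have h2 := hk1 v u hu
      have h3 := hk v s (hTV hs) (by
        rintro rfl
        exact hv.1 ((hTmem v.2).1 hs))
      rw [map_sub] at h2 h3
      simp only [LinearMap.neg_apply]
      linarith
    exact (hP.le_finrank_vectorSpan_nbrSet hd0 v.2).trans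
      (Nat.add_le_add_right (Submodule.finrank_mono (vectorSpan_mono ℝ h1)) 1)
  -- A cut functional is maximal over `P` at a single vertex.
  have hkface : ∀ v : vertices P, faceSet (vertices P) (-k v) = {(v : 𝔼)} := by
    intro v
    have hlt : ∀ w ∈ vertices P, w ≠ v → (-k v) w < (-k v) v := by
      intro w hw hwv
      have := hk v w hw hwv
      rw [map_sub] at this
      simp only [LinearMap.neg_apply]
      linarith
    have hv : (v : 𝔼) ∈ faceSet (vertices P) (-k v) := by
      refine ⟨v.2, fun w hw => ?_⟩
      by_cases hwv : w = v
      · rw [hwv]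
      · exact (hlt w hw hwv).le
    rw [faceSet_eq_of_mem hv]
    ext w
    refine ⟨fun hw => ?_, fun hw => ?_⟩
    · by_contra hwv
      exact (hlt w hw.1 hwv).ne hw.2
    · rw [Set.mem_singleton_iff.1 hw]
      exact ⟨v.2, rfl⟩
  have hfk : ∀ (F : facets P) (v : vertices P),
      faceSet (vertices P) (f F) ≠ faceSet (vertices P) (-k v) := by
    intro F v h
    have h1 := hfdim F
    rw [h, hkface, vectorSpan_singleton, finrank_bot] at h1
    omega
  let L : (I.hitFacets A) ⊕ (I.cutVertices A) → 𝔼 →ₗ[ℝ] ℝ :=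
    Sum.elim (fun F => f F.1) (fun v => -k v.1)
  have hmain := card_le_ncard_facets hd hTfin L
    (by rintro (F | v); exacts [hf0 F.1, neg_ne_zero.2 (hk0 v.1)])
    (by rintro (F | v); exacts [hhit F.1 F.2, hcut v.1 v.2])
    (by
      intro i j t ht hij
      have hface : faceSet (vertices P) (L i) = faceSet (vertices P) (L j) := by
        rw [hij, faceSet_smul _ _ ht]
      rcases i with F | v <;> rcases j with F' | w
      · have h1 : (F.1 : Set 𝔼) = F'.1 := by
          rw [hfF F.1, hfF F'.1]
          exact congrArg _ hface
        rw [Subtype.ext (Subtype.ext h1)]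
      · exact absurd hface (hfk F.1 w.1)
      · exact absurd hface.symm (hfk F'.1 v.1)
      · have h1 : ({((v : vertices P) : 𝔼)} : Set 𝔼) = {((w : vertices P) : 𝔼)} := by
          rw [← hkface, ← hkface]
          exact hface
        rw [Subtype.ext (Subtype.ext (Set.singleton_eq_singleton_iff.1 h1))])
  rw [Fintype.card_sum, Fintype.card_coe, Fintype.card_coe] at hmain
  exact hmain

end SimplePolytope

/-! ### The expected number of facets and its lower tail -/

theorem mainTheorem5 (d : ℕ) (hd : 2 ≤ d) (P : Set (EuclideanSpace ℝ (Fin d)))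
    (hP : IsSimplePolytope P) (m : ℕ) (hm : (facets P).ncard = m)
    (n : ℝ) (hn : n ≤ ((vertices P).ncard : ℝ)) (p : unitInterval) (q : ℝ) (hq : q = 1 - (p : ℝ)) :
    (Integrable (fun S => (numFacets P S : ℝ)) (vertexSample P p) ∧
      (p : ℝ) ^ d * m + n * q * (p : ℝ) ^ d ≤ ∫ S, (numFacets P S : ℝ) ∂(vertexSample P p)) ∧
    ∀ ε : ℝ, 0 < ε →
      1 - Real.exp (-2 * (ε * q * (p : ℝ) ^ d / d) ^ 2 * n)
          - Real.exp (-(m * (p : ℝ) ^ d * ε ^ 2) / 2) ≤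
        (vertexSample P p).real
          {S | (1 - ε) * ((p : ℝ) ^ d * m + n * q * (p : ℝ) ^ d) ≤ (numFacets P S : ℝ)} := by
  classical
  have hp0 : (0 : ℝ) ≤ p := p.2.1
  have hp1 : (p : ℝ) ≤ 1 := p.2.2
  have hq0 : 0 ≤ q := by linarith
  have hpd : (0 : ℝ) ≤ (p : ℝ) ^ d := by positivity
  have hd0 : (0 : ℝ) < d := by positivity
  have hfin : Finite (vertices P) := hP.1.finite_vertices
  have hfacets : Finite (facets P) := by
    have := finite_facets_convexHull hP.1.finite_vertices
    rwa [hP.1.convexHull_vertices] at this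
  have := Fintype.ofFinite (vertices P)
  have := Fintype.ofFinite (facets P)
  have hmcard : Fintype.card (facets P) = m := by
    rw [← hm, ← Nat.card_coe_set_eq, Nat.card_eq_fintype_card]
  set N : ℝ := (Fintype.card (vertices P) : ℝ) with hN
  have hnN : n ≤ N := by
    rwa [hN, ← Nat.card_eq_fintype_card, Nat.card_coe_set_eq]
  set I := simpleIncidence hP (by omega) with hI
  have hprob : IsProbabilityMeasure (vertexSample P p) := by
    unfold vertexSample
    infer_instance
  set M := binomialExp (p : ℝ) Finset.univ I.localCount with hM
  have hMval : M = (p : ℝ) ^ d * m + N * q * (p : ℝ) ^ d := by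
    rw [hM, I.binomialExp_localCount hd, hmcard, hq]
  have hMle : (p : ℝ) ^ d * m + n * q * (p : ℝ) ^ d ≤ M := by
    rw [hMval]
    gcongr
  have hlocal : ∀ A : Finset (vertices P),
      I.localCount A ≤ (numFacets P (A : Set (vertices P)) : ℝ) := fun A =>
    (I.localCount_le A).trans
      (by exact_mod_cast card_hitFacets_add_card_cutVertices_le hP hd A)
  refine ⟨⟨Integrable.of_finite, hMle.trans ?_⟩, fun ε hε => ?_⟩
  · rw [vertexSample, integral_setBernoulli_univ]
    exact binomialExp_mono hp0 hp1 fun A _ => hlocal A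
  have hexp := Real.exp_pos (-(m * (p : ℝ) ^ d * ε ^ 2) / 2)
  rcases le_or_gt n 0 with hn0 | hn0
  · -- The first exponential is at least `1`.
    have h1 : 1 ≤ Real.exp (-2 * (ε * q * (p : ℝ) ^ d / d) ^ 2 * n) := by
      refine Real.one_le_exp ?_
      have := sq_nonneg (ε * q * (p : ℝ) ^ d / d)
      nlinarith
    have h2 := measureReal_nonneg (μ := vertexSample P p)
      (s := {S | (1 - ε) * ((p : ℝ) ^ d * m + n * q * (p : ℝ) ^ d) ≤ (numFacets P S : ℝ)})
    linarith
  set thr := (1 - ε) * ((p : ℝ) ^ d * m + n * q * (p : ℝ) ^ d) with hthr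
  have hmean : 0 ≤ (p : ℝ) ^ d * m + n * q * (p : ℝ) ^ d := by positivity
  have hgood : (vertexSample P p).real {S | thr ≤ (numFacets P S : ℝ)} =
      1 - (vertexSample P p).real {S | (numFacets P S : ℝ) < thr} := by
    rw [← probReal_compl_eq_one_sub (Set.toFinite _).measurableSet]
    congr 1
    ext S
    simp
  have hbad : (vertexSample P p).real {S | (numFacets P S : ℝ) < thr} ≤
      Real.exp (-2 * (ε * q * (p : ℝ) ^ d / d) ^ 2 * n) := by
    rcases lt_or_ge 1 ε with hε1 | hε1
    · have hempty : {S | (numFacets P S : ℝ) < thr} = ∅ := by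
        ext S
        have h1 : thr ≤ 0 := mul_nonpos_of_nonpos_of_nonneg (by linarith) hmean
        have h2 : (0 : ℝ) ≤ numFacets P S := Nat.cast_nonneg _
        simp only [Set.mem_ofPred_eq, Set.mem_empty_iff_false, iff_false, not_lt]
        linarith
      rw [hempty, measureReal_empty]
      exact (Real.exp_pos _).le
    have hthrM : thr ≤ M - ε * M := by
      have := mul_le_mul_of_nonneg_left hMle (by linarith : 0 ≤ 1 - ε)
      linarith
    have hN0 : 0 < N := hn0.trans_le hnN
    have hne : (Finset.univ : Finset (vertices P)).Nonempty := by
      rw [← Finset.card_pos, Finset.card_univ]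
      have h := hN0
      rw [hN] at h
      exact_mod_cast h
    have hM0 : N * q * (p : ℝ) ^ d ≤ M := by
      rw [hMval]
      have : 0 ≤ (p : ℝ) ^ d * m := by positivity
      linarith
    have hNq : 0 ≤ N * q * (p : ℝ) ^ d := by positivity
    calc (vertexSample P p).real {S | (numFacets P S : ℝ) < thr}
        = ∫ S, (if (numFacets P S : ℝ) < thr then (1 : ℝ) else 0) ∂(vertexSample P p) := by
          rw [← integral_indicator_one (Set.toFinite _).measurableSet]
          refine integral_congr_ae (Filter.Eventually.of_forall fun S => ?_)
          simp [Set.indicator_apply]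
      _ = binomialExp (p : ℝ) Finset.univ fun A : Finset (vertices P) =>
            if (numFacets P (A : Set (vertices P)) : ℝ) < thr then (1 : ℝ) else 0 := by
          rw [vertexSample, integral_setBernoulli_univ]
      _ ≤ binomialExp (p : ℝ) Finset.univ fun A : Finset (vertices P) =>
            if I.localCount A ≤ M - ε * M then (1 : ℝ) else 0 := by
          refine binomialExp_mono hp0 hp1 fun A _ => ?_
          have := hlocal A
          split_ifs with h1 h2 h2
          · exact le_rfl
          · exact absurd (by linarith) h2
          · exact zero_le_one
          · exact le_rfl
      _ ≤ Real.exp (-2 * (ε * M) ^ 2 / (N * (d : ℝ) ^ 2)) := by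
          have h := binomialExp_lower_tail hp0 hp1 hd0 hne I.localCount
            (fun A _ i _ hi => I.abs_localCount_insert_sub_le hd hi) (t := ε * M)
            (mul_nonneg hε.le (hNq.trans hM0))
          rwa [Finset.card_univ] at h
      _ ≤ _ := by
          -- Only the part `N q p ^ d` of the mean is used.
          refine Real.exp_le_exp.2 ?_
          have h1 : (N * q * (p : ℝ) ^ d) ^ 2 ≤ M ^ 2 := by gcongr
          have h2 : (ε * q * (p : ℝ) ^ d / d) ^ 2 * n ≤ (ε * M) ^ 2 / (N * (d : ℝ) ^ 2) := by
            calc (ε * q * (p : ℝ) ^ d / d) ^ 2 * n ≤ (ε * q * (p : ℝ) ^ d / d) ^ 2 * N := by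
                  gcongr
              _ = ε ^ 2 * (N * q * (p : ℝ) ^ d) ^ 2 / (N * (d : ℝ) ^ 2) := by
                  field_simp
              _ ≤ ε ^ 2 * M ^ 2 / (N * (d : ℝ) ^ 2) := by gcongr
              _ = _ := by ring
          have h3 : -2 * (ε * M) ^ 2 / (N * (d : ℝ) ^ 2) =
              -2 * ((ε * M) ^ 2 / (N * (d : ℝ) ^ 2)) := by ring
          rw [h3, mul_assoc]
          linarith
  rw [hgood]
  linarith
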